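/- Consider a stable $M|G|1$ queue: Poisson arrivals of rate $\lambda>0$; i.i.d. service times, independent of the arrivals, with mean $1/\mu\in(0,\infty)$ and finite second moment $K/\mu^2$; traffic load $\rho=\lambda/\mu<1$. There are two classes, premium and ordinary, served under preemptive-resume priority for the premium class and first come first served within each class. Every customer joins the premium class, at the price $C\in\mathbb R$, with probability $\phi\in[0,1]$, independently of everything else, and otherwise stays in the ordinary class. The waiting time is the time in the system minus the own service time. Let $E[W_p]$ and $E[W_o]$ be the steady-state expected waiting times (the limits, as $n\to\infty$, of the expected waiting time of the $n$-th customer of a queue that is initially empty) of a customer who joins the premium class and of one who stays in the ordinary class, when all the others use $\phi$. Put $C(\phi)=E[W_o]-E[W_p]$. A customer who joins with probability $q$ while the others use $\phi$ has expected cost $c(q,\phi)=q\,(E[W_p]+C)+(1-q)\,E[W_o]$. The strategy $q$ is a best response to $\phi$ if it minimizes $c(\cdot,\phi)$ over $[0,1]$; $\phi$ is an equilibrium if it is a best response to itself. It is pure if $\phi\in\{0,1\}$ ("no one joins", "everyone joins") and mixed if $0<\phi<1$. An equilibrium $\phi^*$ is evolutionarily stable (ESS) if no other equilibrium is a best response to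 $\phi^*$. A strategy $\phi^*$ cannot be invaded by an initially rare strategy if for every $q\ne\phi^*$ one has $c(\phi^*,(1-\varepsilon)\phi^*+\varepsilon q)<c(q,(1-\varepsilon)\phi^*+\varepsilon q)$ for all sufficiently small $\varepsilon>0$. **Theorem.** The limits that define $E[W_p]$ and $E[W_o]$ exist and are finite for every $\phi\in[0,1]$, $$C(\phi)=\frac{K\rho+(2-K)\phi\rho(1-\rho)}{2\mu(1-\rho)(1-\phi\rho)},$$ and $C(\cdot)$ attains a minimum and a maximum on $[0,1]$. For every $C\in\mathbb R$: 1. If $C<\min C(\phi)$, then $\phi=1$ is the unique equilibrium. 2. If $C>\max C(\phi)$, then $\phi=0$ is the unique equilibrium. 3. If $\min C(\phi)<C<\max C(\phi)$ and $C(\phi)$ is monotone decreasing, then the unique equilibrium is $$\phi_e=\frac{2\mu C(1-\rho)-K\rho}{\rho(1-\rho)(2\mu C+2-K)},$$ and $0<\phi_e<1$. 4. If $\min C(\phi)<C<\max C(\phi)$ and $C(\phi)$ is monotone increasing, then $0<\phi_e<1$ and the equilibria are exactly $0$, $\phi_e$ and $1$. 5. If $C$ is neither $\min C(\phi)$ nor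 $\max C(\phi)$, or if $C(\phi)$ is strictly decreasing, then every pure equilibrium is ESS, and it cannot be invaded by an initially rare strategy. 6. A mixed equilibrium is ESS if and only if it is the unique equilibrium. Likewise, it cannot be invaded by an initially rare strategy if and only if it is the unique equilibrium. -/

import Mathlib

open MeasureTheory ProbabilityTheory Filter Topology Set
open scoped ENNReal unitInterval

/-- Parameters of a stable M|G|1 queue: Poisson arrivals of rate `lam`, i.i.d. service times with
law `service` on `[0, ∞)` having positive mean and finite second moment, and traffic load `< 1`. -/
structure MG1Queue where
  lam : ℝ
  lam_pos : 0 < lam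
  service : Measure ℝ
  service_prob : IsProbabilityMeasure service
  service_nonneg : ∀ᵐ s ∂service, 0 ≤ s
  service_sq_integrable : Integrable (fun s : ℝ => s ^ 2) service
  service_mean_pos : 0 < ∫ s, s ∂service
  stable : lam * ∫ s, s ∂service < 1

/-- The data of one arriving customer: `c.1` is the time from this arrival to the next one,
`c.2.1` is the service time, and `c.2.2` says whether the customer joins the premium class. -/
abbrev Customer : Type := ℝ × ℝ × Bool

/-- Work that the customer brings to the premium class. -/
def premService (c : Customer) : ℝ := if c.2.2 then c.2.1 else 0

/-- Work that the customer brings to the ordinary class. -/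
def ordService (c : Customer) : ℝ := if c.2.2 then 0 else c.2.1

/-- Unfinished premium work just before the `n`-th arrival. The system is empty before arrival `0`,
and the server works on premium customers whenever there are any. -/
def premWork (ω : ℕ → Customer) : ℕ → ℝ
  | 0 => 0
  | n + 1 => max 0 (premWork ω n + premService (ω n) - (ω n).1)

/-- Unfinished ordinary work just before the `n`-th arrival. Between two arrivals the server works
on ordinary customers exactly during the time that is left once the premium work is finished;
preempted work is resumed, not repeated. -/
def ordWork (ω : ℕ → Customer) : ℕ → ℝ
  | 0 => 0
  | n + 1 => max 0 (ordWork ω n + ordService (ω n)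
      - max 0 ((ω n).1 - (premWork ω n + premService (ω n))))

/-- The time an ordinary customer spends in the system up to the `k`-th subsequent arrival, when
`x` is the work that is to be done from now on until the customer has left if no premium customer
arrives in the meantime. Here `(ω 0).1` is the time until the next arrival and `ω 1, ω 2, …` are the
subsequent customers. If the next arrival comes before time `x`, then the work ahead has
decreased by the elapsed time, and the service time of the new customer is added to it precisely
when that customer joins the premium class. -/
noncomputable def ordTime : ℕ → ℝ → (ℕ → Customer) → ℝ
  | 0, _, _ => 0
  | k + 1, x, ω =>
      if x ≤ (ω 0).1 then x
      else (ω 0).1 + ordTime k (x - (ω 0).1 + premService (ω 1)) (fun j => ω (j + 1))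

/-- Waiting time (time in the system minus own service time) of the `n`-th customer if he joins the
premium class: the premium work found on arrival is served before him, first come first served. -/
noncomputable def premDelay (ω : ℕ → Customer) (n : ℕ) : ℝ≥0∞ :=
  ENNReal.ofReal (premWork ω n)

/-- Waiting time (time in the system minus own service time, thus including the time during which
his service is interrupted) of the `n`-th customer if he remains in the ordinary class. -/
noncomputable def ordDelay (ω : ℕ → Customer) (n : ℕ) : ℝ≥0∞ :=
  (⨆ k, ENNReal.ofReal
      (ordTime k (premWork ω n + ordWork ω n + (ω n).2.1) (fun j => ω (n + j))))
    - ENNReal.ofReal (ω n).2.1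

namespace MG1Queue

variable (Q : MG1Queue)

/-- Mean service rate. -/
noncomputable def mu : ℝ := (∫ s, s ∂Q.service)⁻¹

/-- Traffic load. -/
noncomputable def rho : ℝ := Q.lam / Q.mu

/-- Variance parameter: the second moment of service equals `K / μ ^ 2`. -/
noncomputable def K : ℝ := Q.mu ^ 2 * ∫ s, s ^ 2 ∂Q.service

/-- Law of the data of one customer when every customer joins the premium class with
probability `φ`: independent exponential interarrival time, service time and class. -/
noncomputable def customerLaw (φ : I) : Measure Customer :=
  (expMeasure Q.lam).prod (Q.service.prod (bernoulliMeasure true false φ))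

instance customerLaw_prob (φ : I) : IsProbabilityMeasure (Q.customerLaw φ) := by
  have := Q.service_prob
  have := isProbabilityMeasure_expMeasure Q.lam_pos
  unfold customerLaw
  infer_instance

/-- Law of the i.i.d. sequence of customers. -/
noncomputable def law (φ : I) : Measure (ℕ → Customer) :=
  Measure.infinitePi (fun _ : ℕ => Q.customerLaw φ)

/-- Expected waiting time of the `n`-th customer if he joins the premium class, while all the other
customers join it with probability `φ`. -/
noncomputable def premMeanDelay (φ : I) (n : ℕ) : ℝ≥0∞ := ∫⁻ ω, premDelay ω n ∂Q.law φ

/-- Expected waiting time of the `n`-th customer if he stays in the ordinary class, while all the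
other customers join the premium class with probability `φ`. -/
noncomputable def ordMeanDelay (φ : I) (n : ℕ) : ℝ≥0∞ := ∫⁻ ω, ordDelay ω n ∂Q.law φ

/-- Steady-state expected waiting time `E[W_p]` in the premium class. -/
noncomputable def Wp (φ : I) : ℝ := (limUnder atTop (Q.premMeanDelay φ)).toReal

/-- Steady-state expected waiting time `E[W_o]` in the ordinary class. -/
noncomputable def Wo (φ : I) : ℝ := (limUnder atTop (Q.ordMeanDelay φ)).toReal

/-- The function `C(φ) = E[W_o] - E[W_p]`. -/
noncomputable def Cfun (φ : I) : ℝ := Q.Wo φ - Q.Wp φ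

/-- Expected cost of a customer who joins the premium class, at price `C`, with probability `q`
while the rest of the population does so with probability `φ`. -/
noncomputable def cost (C : ℝ) (q φ : I) : ℝ :=
  (q : ℝ) * (Q.Wp φ + C) + (1 - (q : ℝ)) * Q.Wo φ

/-- `q` is a best response to the population strategy `φ`. -/
def IsBestResponse (C : ℝ) (q φ : I) : Prop := ∀ r : I, Q.cost C q φ ≤ Q.cost C r φ

/-- `φ` is a (symmetric Nash) equilibrium: it is a best response to itself. -/
def IsEquilibrium (C : ℝ) (φ : I) : Prop := Q.IsBestResponse C φ φ

/-- Evolutionarily stable strategy: an equilibrium to which no other equilibrium strategy is a best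
response. -/
def IsESS (C : ℝ) (φ : I) : Prop :=
  Q.IsEquilibrium C φ ∧ ¬ ∃ ψ : I, ψ ≠ φ ∧ Q.IsEquilibrium C ψ ∧ Q.IsBestResponse C ψ φ

/-- `φ` cannot be invaded by an initially rare strategy: against every other strategy `q` it does
strictly better in each population in which a small enough fraction `ε` plays `q` and the rest
plays `φ`. -/
def CannotBeInvaded (C : ℝ) (φ : I) : Prop :=
  ∀ q : I, q ≠ φ → ∃ ε₀ : ℝ, 0 < ε₀ ∧ ∀ ε : ℝ, 0 < ε → ε < ε₀ → ∀ ψ : I,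
    (ψ : ℝ) = (1 - ε) * φ + ε * q → Q.cost C φ ψ < Q.cost C q ψ

/-- The fraction `φ_e` of premium customers at price `C` in a mixed equilibrium. -/
noncomputable def phiE (C : ℝ) : ℝ :=
  (2 * Q.mu * C * (1 - Q.rho) - Q.K * Q.rho)
    / (Q.rho * (1 - Q.rho) * (2 * Q.mu * C + 2 - Q.K))

end MG1Queue

/-! Fix φ. The premium work and the total work found by successive arrivals both follow Lindley
recursions with exponential interarrival times of rate λ: an ordinary customer counts as an arrival
with premium work 0, and the total work ignores the order of service (`premWork_add_ordWork`).
Integration by parts against the exponential law turns one step of the recursion into an exact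
identity between moments (`posMoment_lindleyStep`). The queue starts empty, so its moments increase
with n, and the limit of the second-moment identity is the Pollaczek–Khinchine mean r b₂ / (2 (1 - r
b₁)), where b₁ and b₂ are the moments of the work per customer (`tendsto_posMoment_one_lindleyLaw`).
Cancelling second moments in the limit requires a third moment of service, an assumption removed by
truncation.

An ordinary customer who finds total work v and brings service s leaves when v + s and all premium
work arriving meanwhile are finished. First-step analysis at the next arrival gives the mean (v + s)
/ (1 - φρ) (`lintegral_ordSojourn`): this linear function solves the recursion, and a quadratic
potential shows that the error after k arrivals vanishes. Since v is independent of s and of the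
later customers, E[W_o] follows.

Now C(φ) is a quotient of affine functions of φ, so the sign of `slope` decides whether it is
strictly increasing, constant or strictly decreasing. The cost is affine in q with coefficient C -
C(φ), so equilibria are read off from signs, and a mixed one is a point with C(φ) = C. If C(·)
decreases, an excess of joiners makes joining less attractive: the mixed equilibrium is unique and
resists invasion. Otherwise C ≤ C(1), so 1 is a further equilibrium, and always joining can invade.
-/

/-! ### Splitting off the first term of an i.i.d. sequence -/

/-- The sequence with first term `c` and tail `ω`. -/
def consSeq {X : Type*} (c : X) (ω : ℕ → X) : ℕ → X
  | 0 => c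
  | n + 1 => ω n

@[simp] lemma consSeq_zero {X : Type*} (c : X) (ω : ℕ → X) : consSeq c ω 0 = c := rfl

@[simp] lemma consSeq_succ {X : Type*} (c : X) (ω : ℕ → X) (n : ℕ) :
    consSeq c ω (n + 1) = ω n := rfl

@[fun_prop]
lemma measurable_consSeq {X : Type*} [MeasurableSpace X] :
    Measurable (fun p : X × (ℕ → X) => consSeq p.1 p.2) := by
  refine measurable_pi_lambda _ fun n => ?_
  cases n with
  | zero => exact measurable_fst
  | succ n => exact (measurable_pi_apply n).comp measurable_snd

/-- An i.i.d. sequence is its first term followed by an independent copy of the sequence. -/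
lemma map_cons_infinitePi {X : Type*} [MeasurableSpace X] (μ : Measure X)
    [IsProbabilityMeasure μ] :
    (μ.prod (Measure.infinitePi fun _ : ℕ => μ)).map
      (fun p : X × (ℕ → X) => consSeq p.1 p.2) =
      Measure.infinitePi fun _ : ℕ => μ := by
  have hm := measurable_consSeq (X := X)
  refine Measure.eq_infinitePi _ fun s t ht => ?_
  classical
  obtain ⟨N, hN⟩ := s.exists_nat_subset_range
  have hN1 : s ⊆ Finset.range (N + 1) :=
    hN.trans (Finset.range_mono (Nat.le_succ N))
  -- Padding the cylinder by `univ` to all indices below N + 1 lets index 0 split off whether or not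
  -- it lies in `s`.
  set t' : ℕ → Set X := fun i => if i ∈ s then t i else univ with ht'
  have ht'm : ∀ i, MeasurableSet (t' i) := fun i => by
    by_cases h : i ∈ s <;> simp [ht', h, ht]
  have hprod : ∏ i ∈ s, μ (t i) = ∏ i ∈ Finset.range (N + 1), μ (t' i) := by
    rw [← Finset.prod_subset hN1]
    · exact Finset.prod_congr rfl fun i hi => by simp [ht', hi]
    · intro i _ hi
      simp [ht', hi]
  have hpre : (fun p : X × (ℕ → X) => consSeq p.1 p.2) ⁻¹'
      ((s : Set ℕ).pi t) = t' 0 ×ˢ ((Finset.range N : Set ℕ).pi fun i => t' (i + 1)) := by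
    ext p
    simp only [mem_preimage, Set.mem_pi, mem_prod, Finset.mem_coe, Finset.mem_range, ht']
    constructor
    · intro h
      refine ⟨?_, fun i _ => ?_⟩
      · by_cases h0 : 0 ∈ s
        · simpa [h0] using h 0 h0
        · simp [h0]
      · by_cases h0 : i + 1 ∈ s
        · simpa [h0] using h (i + 1) h0
        · simp [h0]
    · rintro ⟨h0, h1⟩ i hi
      cases i with
      | zero => simpa [hi] using h0
      | succ i =>
        have hlt : i < N := by
          have := Finset.mem_range.1 (hN hi)
          omega
        simpa [hi] using h1 i hlt
  rw [Measure.map_apply hm (MeasurableSet.pi s.countable_toSet fun i _ => ht i), hpre,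
    Measure.prod_prod, Measure.infinitePi_pi _ (fun i _ => ht'm (i + 1)), hprod,
    Finset.prod_range_succ', mul_comm]

/-- Splitting off the first term of an i.i.d. sequence in an integral. -/
lemma lintegral_infinitePi_cons {X : Type*} [MeasurableSpace X] (μ : Measure X)
    [IsProbabilityMeasure μ] {f : (ℕ → X) → ℝ≥0∞} (hf : Measurable f) :
    ∫⁻ ω, f ω ∂(Measure.infinitePi fun _ : ℕ => μ) =
      ∫⁻ c, ∫⁻ ω, f (consSeq c ω) ∂(Measure.infinitePi fun _ : ℕ => μ) ∂μ := by
  have hm := measurable_consSeq (X := X)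
  conv_lhs => rw [← map_cons_infinitePi μ]
  rw [lintegral_map hf hm]
  exact lintegral_prod _ (hf.comp hm).aemeasurable

/-! ### Integration against the exponential law -/

lemma lintegral_expMeasure {r : ℝ} (f : ℝ → ℝ≥0∞) :
    ∫⁻ a, f a ∂expMeasure r = ∫⁻ a in Ici 0, ENNReal.ofReal (r * Real.exp (-(r * a))) * f a := by
  have hmeas : Measurable (exponentialPDF r) :=
    (measurable_exponentialPDFReal r).ennreal_ofReal
  have h : expMeasure r = volume.withDensity (exponentialPDF r) := rfl
  rw [h, lintegral_withDensity_eq_lintegral_mul_non_measurable _ hmeas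
    (Eventually.of_forall fun x => ENNReal.ofReal_lt_top), ← lintegral_indicator measurableSet_Ici]
  refine lintegral_congr fun a => ?_
  by_cases ha : 0 ≤ a
  · simp [ha, exponentialPDF_of_nonneg]
  · simp [ha, exponentialPDF_of_neg (not_le.1 ha)]

lemma ae_nonneg_expMeasure {r : ℝ} : ∀ᵐ a ∂expMeasure r, 0 ≤ a := by
  rw [ae_iff, ← lintegral_indicator_one₀ (by measurability), lintegral_expMeasure,
    setLIntegral_congr_fun (g := fun _ => 0) measurableSet_Ici]
  · simp
  · intro a ha
    simp [show (0 : ℝ) ≤ a from ha]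

/-- Integration by parts against the exponential law. -/
lemma lintegral_expMeasure_pow {r : ℝ} (hr : 0 < r) (k : ℕ) (y : ℝ) :
    ∫⁻ a, ENNReal.ofReal (y - a) ^ (k + 1) ∂expMeasure r +
      ENNReal.ofReal ((k + 1) / r) *
        ∫⁻ a, (Iio y).indicator (fun a => ENNReal.ofReal (y - a) ^ k) a ∂expMeasure r =
      ENNReal.ofReal y ^ (k + 1) := by
  -- The indicator matters only for k = 0, where `ENNReal.ofReal (y - a) ^ 0 = 1` even for a ≥ y.
  have hm : Measurable fun a => (Iio y).indicator (fun a => ENNReal.ofReal (y - a) ^ k) a :=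
    Measurable.indicator (by fun_prop) measurableSet_Iio
  rw [← lintegral_const_mul _ hm, ← lintegral_add_right _ (hm.const_mul _), lintegral_expMeasure]
  rcases le_or_gt y 0 with hy | hy
  · rw [setLIntegral_congr_fun (g := fun _ => 0) measurableSet_Ici]
    · simp [ENNReal.ofReal_of_nonpos hy]
    · intro a ha
      have ha : (0 : ℝ) ≤ a := ha
      have h1 : ¬ a < y := by linarith
      have h2 : ENNReal.ofReal (y - a) = 0 := ENNReal.ofReal_of_nonpos (by linarith)
      simp [h1, h2]
  · have hsplit : ∀ a ∈ Ici (0 : ℝ), ENNReal.ofReal (r * Real.exp (-(r * a))) *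
        (ENNReal.ofReal (y - a) ^ (k + 1) + ENNReal.ofReal ((k + 1) / r) *
          (Iio y).indicator (fun a => ENNReal.ofReal (y - a) ^ k) a) =
        (Iio y).indicator (fun a => ENNReal.ofReal
          (r * Real.exp (-(r * a)) * (y - a) ^ (k + 1) +
            (k + 1) * Real.exp (-(r * a)) * (y - a) ^ k)) a := by
      intro a ha
      by_cases hay : a < y
      · have h0 : 0 ≤ y - a := by linarith
        simp only [mem_Iio, hay, indicator_of_mem]
        rw [← ENNReal.ofReal_pow h0, ← ENNReal.ofReal_pow h0, ← ENNReal.ofReal_mul (by positivity),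
          ← ENNReal.ofReal_add (by positivity) (by positivity),
          ← ENNReal.ofReal_mul (by positivity)]
        congr 1
        field_simp
      · have h2 : ENNReal.ofReal (y - a) = 0 := ENNReal.ofReal_of_nonpos (by linarith)
        simp [hay, h2]
    rw [setLIntegral_congr_fun measurableSet_Ici hsplit, setLIntegral_indicator measurableSet_Iio]
    have hset : Iio y ∩ Ici 0 = Ico 0 y := by
      ext a; simp [and_comm]
    rw [hset, setLIntegral_congr Ico_ae_eq_Ioc]
    -- The integrand is the derivative of -exp(-ra) (y - a)^(k+1), whose increment over [0, y] is
    -- y^(k+1).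
    have hcont : Continuous fun a => r * Real.exp (-(r * a)) * (y - a) ^ (k + 1) +
        (k + 1) * Real.exp (-(r * a)) * (y - a) ^ k := by fun_prop
    rw [← ofReal_integral_eq_lintegral_ofReal (hcont.integrableOn_Ioc),
      ← intervalIntegral.integral_of_le hy.le,
      intervalIntegral.integral_eq_sub_of_hasDerivAt
        (f := fun a => -(Real.exp (-(r * a)) * (y - a) ^ (k + 1)))
        _ (hcont.intervalIntegrable _ _), ← ENNReal.ofReal_pow hy.le]
    · simp
    · intro a _
      have h1 : HasDerivAt (fun a => Real.exp (-(r * a))) (Real.exp (-(r * a)) * (-(r * 1))) a :=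
        (((hasDerivAt_id a).const_mul r).neg).exp
      have h2 : HasDerivAt (fun a => (y - a) ^ (k + 1)) ((↑(k + 1)) * (y - a) ^ k * (-1)) a := by
        exact ((hasDerivAt_id a).const_sub y).pow (k + 1)
      refine (h1.mul h2).neg.congr_deriv ?_
      push_cast
      ring
    · refine (ae_restrict_iff' measurableSet_Ioc).2 (Eventually.of_forall fun a ha => ?_)
      have h0 : 0 ≤ y - a := by linarith [ha.2]
      simp only [Pi.zero_apply]
      positivity

/-! ### Lindley recursion and the Pollaczek–Khinchine mean -/

/-- The `k`-th moment of the positive part of a law on `ℝ`. -/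
noncomputable def posMoment (k : ℕ) (μ : Measure ℝ) : ℝ≥0∞ := ∫⁻ x, ENNReal.ofReal x ^ k ∂μ

lemma posMoment_le_one_add (k : ℕ) (μ : Measure ℝ) [IsProbabilityMeasure μ] :
    posMoment k μ ≤ 1 + posMoment (k + 1) μ := by
  have h : (1 : ℝ≥0∞) = ∫⁻ _, 1 ∂μ := by simp
  rw [posMoment, posMoment, h, ← lintegral_add_left measurable_const]
  refine lintegral_mono fun x => ?_
  rcases le_total (ENNReal.ofReal x) 1 with hx | hx
  · exact (pow_le_one₀ zero_le hx).trans le_self_add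
  · exact (pow_le_pow_right₀ hx (Nat.le_succ k)).trans le_add_self

lemma posMoment_ne_top_of_succ {k : ℕ} {μ : Measure ℝ} [IsProbabilityMeasure μ]
    (h : posMoment (k + 1) μ ≠ ⊤) : posMoment k μ ≠ ⊤ :=
  ne_top_of_le_ne_top (by simp [h]) (posMoment_le_one_add k μ)

/-- The usual stochastic order. -/
def StochLE (μ ν : Measure ℝ) : Prop :=
  ∀ f : ℝ → ℝ≥0∞, Monotone f → ∫⁻ x, f x ∂μ ≤ ∫⁻ x, f x ∂ν

lemma StochLE.posMoment_le {μ ν : Measure ℝ} (h : StochLE μ ν) (k : ℕ) :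
    posMoment k μ ≤ posMoment k ν :=
  h _ fun _ _ hxy => pow_le_pow_left' (ENNReal.ofReal_le_ofReal hxy) k

/-- One step of the Lindley recursion: the workload just before the next arrival, when the workload
just before the present one has law `μ`, the customer brings work of law `η`, and interarrival times
are exponential of rate `r`. -/
noncomputable def lindleyStep (r : ℝ) (η μ : Measure ℝ) : Measure ℝ :=
  (μ.prod ((expMeasure r).prod η)).map (fun p => max 0 (p.1 + p.2.2 - p.2.1))

/-- The law of the workload just before the `n`-th arrival in an initially empty queue. -/
noncomputable def lindleyLaw (r : ℝ) (η : Measure ℝ) : ℕ → Measure ℝ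
  | 0 => Measure.dirac 0
  | n + 1 => lindleyStep r η (lindleyLaw r η n)

section

variable {r : ℝ} {η μ : Measure ℝ}

lemma isProbabilityMeasure_lindleyStep (hr : 0 < r) [IsProbabilityMeasure η]
    [IsProbabilityMeasure μ] : IsProbabilityMeasure (lindleyStep r η μ) := by
  have := isProbabilityMeasure_expMeasure hr
  exact Measure.isProbabilityMeasure_map (by fun_prop)

lemma isProbabilityMeasure_lindleyLaw (hr : 0 < r) [IsProbabilityMeasure η] (n : ℕ) :
    IsProbabilityMeasure (lindleyLaw r η n) := by
  induction n with
  | zero => exact Measure.dirac.isProbabilityMeasure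
  | succ n ih => exact isProbabilityMeasure_lindleyStep hr

lemma lintegral_lindleyStep (hr : 0 < r) [IsProbabilityMeasure η] [IsProbabilityMeasure μ]
    {f : ℝ → ℝ≥0∞} (hf : Measurable f) :
    ∫⁻ x, f x ∂lindleyStep r η μ =
      ∫⁻ v, ∫⁻ b, ∫⁻ a, f (max 0 (v + b - a)) ∂expMeasure r ∂η ∂μ := by
  have := isProbabilityMeasure_expMeasure hr
  rw [lindleyStep, lintegral_map hf (by fun_prop), lintegral_prod _ (by fun_prop)]
  refine lintegral_congr fun v => ?_
  rw [lintegral_prod_symm _ (by fun_prop)]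

lemma ae_nonneg_lindleyStep : ∀ᵐ x ∂lindleyStep r η μ, 0 ≤ x :=
  (ae_map_iff (by fun_prop) measurableSet_Ici).2 (Eventually.of_forall fun _ => le_max_left _ _)

lemma ae_nonneg_lindleyLaw (n : ℕ) : ∀ᵐ x ∂lindleyLaw r η n, 0 ≤ x := by
  cases n with
  | zero => exact (ae_dirac_iff measurableSet_Ici).2 le_rfl
  | succ n => exact ae_nonneg_lindleyStep

/-- For a fixed interarrival time the new workload is nondecreasing both in the old workload and in
the work brought. Varying the former gives monotonicity in n, varying the latter the comparison with
truncated service. -/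
lemma lindleyStep_mono {η' μ' : Measure ℝ} (hr : 0 < r) [IsProbabilityMeasure η]
    [IsProbabilityMeasure μ] [IsProbabilityMeasure η'] [IsProbabilityMeasure μ']
    (hη : StochLE η η') (hμ : StochLE μ μ') :
    StochLE (lindleyStep r η μ) (lindleyStep r η' μ') := by
  intro f hf
  have hmono : ∀ {x y : ℝ} (a : ℝ), x ≤ y → f (max 0 (x - a)) ≤ f (max 0 (y - a)) :=
    fun a h => hf (max_le_max le_rfl (by linarith))
  rw [lintegral_lindleyStep hr hf.measurable, lintegral_lindleyStep hr hf.measurable]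
  calc _ ≤ ∫⁻ v, ∫⁻ b, ∫⁻ a, f (max 0 (v + b - a)) ∂expMeasure r ∂η' ∂μ :=
        lintegral_mono fun v => hη _ fun b b' hb => lintegral_mono fun a => hmono a (by linarith)
    _ ≤ _ := hμ _ fun v v' hv => lintegral_mono fun b => lintegral_mono fun a =>
        hmono a (by linarith)

lemma lindleyLaw_mono_service {η' : Measure ℝ} (hr : 0 < r) [IsProbabilityMeasure η]
    [IsProbabilityMeasure η'] (hη : StochLE η η') (n : ℕ) :
    StochLE (lindleyLaw r η n) (lindleyLaw r η' n) := by
  induction n with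
  | zero => exact fun f _ => le_rfl
  | succ n ih =>
    have := isProbabilityMeasure_lindleyLaw (η := η) hr n
    have := isProbabilityMeasure_lindleyLaw (η := η') hr n
    exact lindleyStep_mono hr hη ih

/-- The empty state is the smallest possible workload, and the order that this creates between times
0 and 1 is propagated by the recursion. -/
lemma lindleyLaw_le_succ (hr : 0 < r) [IsProbabilityMeasure η] (n : ℕ) :
    StochLE (lindleyLaw r η n) (lindleyLaw r η (n + 1)) := by
  induction n with
  | zero =>
    intro f hf
    have := isProbabilityMeasure_lindleyLaw (η := η) hr 1
    calc ∫⁻ x, f x ∂lindleyLaw r η 0 = ∫⁻ _, f 0 ∂lindleyLaw r η 1 := by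
          rw [lintegral_const, measure_univ, mul_one, lindleyLaw, lintegral_dirac' _ hf.measurable]
      _ ≤ _ := lintegral_mono_ae ((ae_nonneg_lindleyLaw 1).mono fun x hx => hf hx)
  | succ n ih =>
    have := isProbabilityMeasure_lindleyLaw (η := η) hr n
    have := isProbabilityMeasure_lindleyLaw (η := η) hr (n + 1)
    exact lindleyStep_mono hr (fun f _ => le_rfl) ih

/-- Apply `lintegral_expMeasure_pow` with y = v + b for each workload v and work b. The positive
part disappears on the right, so that moments can be expanded by the binomial formula. Additive form
in `ℝ≥0∞` needs no finiteness. -/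
lemma posMoment_lindleyStep (hr : 0 < r) [IsProbabilityMeasure η] [IsProbabilityMeasure μ]
    (k : ℕ) :
    posMoment (k + 2) (lindleyStep r η μ) +
      ENNReal.ofReal ((k + 2) / r) * posMoment (k + 1) (lindleyStep r η μ) =
      ∫⁻ v, ∫⁻ b, ENNReal.ofReal (v + b) ^ (k + 2) ∂η ∂μ := by
  have := isProbabilityMeasure_expMeasure hr
  rw [posMoment, posMoment, ← lintegral_const_mul _ (by fun_prop),
    ← lintegral_add_right _ (by fun_prop), lintegral_lindleyStep hr (by fun_prop)]
  refine lintegral_congr fun v => lintegral_congr fun b => ?_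
  rw [← lintegral_expMeasure_pow hr (k + 1) (v + b), ← lintegral_const_mul _
    (Measurable.indicator (by fun_prop) measurableSet_Iio),
    ← lintegral_add_left (by fun_prop)]
  refine lintegral_congr fun a => ?_
  have h1 : ENNReal.ofReal (max 0 (v + b - a)) = ENNReal.ofReal (v + b - a) := by
    rw [max_comm, ENNReal.ofReal_max, ENNReal.ofReal_zero, max_eq_left zero_le]
  have h2 : (Iio (v + b)).indicator (fun a => ENNReal.ofReal (v + b - a) ^ (k + 1)) a =
      ENNReal.ofReal (v + b - a) ^ (k + 1) := by
    by_cases h : a < v + b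
    · simp [h]
    · simp [h, ENNReal.ofReal_of_nonpos (show v + b - a ≤ 0 by linarith)]
  rw [h1, h2]
  congr 3
  push_cast
  ring

lemma posMoment_two_lindleyStep (hr : 0 < r) [IsProbabilityMeasure η] [IsProbabilityMeasure μ]
    (hη : ∀ᵐ x ∂η, 0 ≤ x) (hμ : ∀ᵐ x ∂μ, 0 ≤ x) :
    posMoment 2 (lindleyStep r η μ) + ENNReal.ofReal (2 / r) * posMoment 1 (lindleyStep r η μ) =
      posMoment 2 μ + 2 * posMoment 1 η * posMoment 1 μ + posMoment 2 η := by
  have h := posMoment_lindleyStep (η := η) (μ := μ) hr 0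
  simp only [Nat.cast_zero, zero_add] at h
  rw [h]
  have h1 : ∀ᵐ v ∂μ, ∫⁻ b, ENNReal.ofReal (v + b) ^ 2 ∂η =
      ENNReal.ofReal v ^ 2 + 2 * posMoment 1 η * ENNReal.ofReal v ^ 1 + posMoment 2 η := by
    filter_upwards [hμ] with v hv
    calc _ = ∫⁻ b, (ENNReal.ofReal v ^ 2 + 2 * ENNReal.ofReal v * ENNReal.ofReal b ^ 1 +
          ENNReal.ofReal b ^ 2) ∂η := by
          refine lintegral_congr_ae (hη.mono fun b hb => ?_)
          simp only [ENNReal.ofReal_add hv hb]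
          ring
      _ = _ := by
          rw [lintegral_add_right _ (by fun_prop), lintegral_add_right _ (by fun_prop),
            lintegral_const_mul _ (by fun_prop), lintegral_const, measure_univ]
          simp only [posMoment]
          ring
  rw [lintegral_congr_ae h1, lintegral_add_right _ (by fun_prop),
    lintegral_add_right _ (by fun_prop), lintegral_const_mul _ (by fun_prop), lintegral_const,
    measure_univ, mul_one]
  rfl

lemma posMoment_three_lindleyStep (hr : 0 < r) [IsProbabilityMeasure η] [IsProbabilityMeasure μ]
    (hη : ∀ᵐ x ∂η, 0 ≤ x) (hμ : ∀ᵐ x ∂μ, 0 ≤ x) :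
    posMoment 3 (lindleyStep r η μ) + ENNReal.ofReal (3 / r) * posMoment 2 (lindleyStep r η μ) =
      posMoment 3 μ + 3 * posMoment 1 η * posMoment 2 μ + 3 * posMoment 2 η * posMoment 1 μ +
        posMoment 3 η := by
  have h := posMoment_lindleyStep (η := η) (μ := μ) hr 1
  norm_num at h
  rw [h]
  have h1 : ∀ᵐ v ∂μ, ∫⁻ b, ENNReal.ofReal (v + b) ^ 3 ∂η =
      ENNReal.ofReal v ^ 3 + 3 * posMoment 1 η * ENNReal.ofReal v ^ 2 +
        3 * posMoment 2 η * ENNReal.ofReal v ^ 1 + posMoment 3 η := by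
    filter_upwards [hμ] with v hv
    calc _ = ∫⁻ b, (ENNReal.ofReal v ^ 3 + 3 * ENNReal.ofReal v ^ 2 * ENNReal.ofReal b ^ 1 +
          3 * ENNReal.ofReal v * ENNReal.ofReal b ^ 2 + ENNReal.ofReal b ^ 3) ∂η := by
          refine lintegral_congr_ae (hη.mono fun b hb => ?_)
          simp only [ENNReal.ofReal_add hv hb]
          ring
      _ = _ := by
          rw [lintegral_add_right _ (by fun_prop), lintegral_add_right _ (by fun_prop),
            lintegral_add_right _ (by fun_prop),
            lintegral_const_mul _ (by fun_prop), lintegral_const_mul _ (by fun_prop),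
            lintegral_const, measure_univ]
          simp only [posMoment]
          ring
  rw [lintegral_congr_ae h1, lintegral_add_right _ (by fun_prop),
    lintegral_add_right _ (by fun_prop), lintegral_add_right _ (by fun_prop),
    lintegral_const_mul _ (by fun_prop), lintegral_const_mul _ (by fun_prop), lintegral_const,
    measure_univ, mul_one]
  rfl

lemma posMoment_lindleyLaw_zero (k : ℕ) : posMoment (k + 1) (lindleyLaw r η 0) = 0 := by
  rw [posMoment, lindleyLaw, lintegral_dirac' _ (by fun_prop)]
  simp

lemma posMoment_two_lindleyLaw_ne_top (hr : 0 < r) [IsProbabilityMeasure η]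
    (hη : ∀ᵐ x ∂η, 0 ≤ x) (h2 : posMoment 2 η ≠ ⊤) (n : ℕ) :
    posMoment 2 (lindleyLaw r η n) ≠ ⊤ := by
  induction n with
  | zero => simp [posMoment_lindleyLaw_zero]
  | succ n ih =>
    have := isProbabilityMeasure_lindleyLaw (η := η) hr n
    refine ne_top_of_le_ne_top ?_ ((le_self_add).trans
      (posMoment_two_lindleyStep hr hη (ae_nonneg_lindleyLaw (r := r) (η := η) n)).le)
    have h1 := posMoment_ne_top_of_succ h2
    have h1' := posMoment_ne_top_of_succ ih
    finiteness

lemma posMoment_three_lindleyLaw_ne_top (hr : 0 < r) [IsProbabilityMeasure η]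
    (hη : ∀ᵐ x ∂η, 0 ≤ x) (h3 : posMoment 3 η ≠ ⊤) (n : ℕ) :
    posMoment 3 (lindleyLaw r η n) ≠ ⊤ := by
  induction n with
  | zero => simp [posMoment_lindleyLaw_zero]
  | succ n ih =>
    have := isProbabilityMeasure_lindleyLaw (η := η) hr n
    refine ne_top_of_le_ne_top ?_ ((le_self_add).trans
      (posMoment_three_lindleyStep hr hη (ae_nonneg_lindleyLaw (r := r) (η := η) n)).le)
    have h2 := posMoment_ne_top_of_succ h3
    have h1 := posMoment_ne_top_of_succ h2
    have h2' := posMoment_ne_top_of_succ ih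
    have h1' := posMoment_ne_top_of_succ h2'
    finiteness

lemma toReal_posMoment_two_lindleyLaw (hr : 0 < r) [IsProbabilityMeasure η]
    (hη : ∀ᵐ x ∂η, 0 ≤ x) (h2 : posMoment 2 η ≠ ⊤) (n : ℕ) :
    (posMoment 2 (lindleyLaw r η (n + 1))).toReal +
      2 / r * (posMoment 1 (lindleyLaw r η (n + 1))).toReal =
      (posMoment 2 (lindleyLaw r η n)).toReal +
        2 * (posMoment 1 η).toReal * (posMoment 1 (lindleyLaw r η n)).toReal +
        (posMoment 2 η).toReal := by
  have := isProbabilityMeasure_lindleyLaw (η := η) hr n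
  have := isProbabilityMeasure_lindleyLaw (η := η) hr (n + 1)
  have h := congrArg ENNReal.toReal
    (posMoment_two_lindleyStep hr hη (ae_nonneg_lindleyLaw (r := r) (η := η) n))
  have e1 := posMoment_ne_top_of_succ h2
  have e2 := posMoment_two_lindleyLaw_ne_top hr hη h2 n
  have e3 := posMoment_ne_top_of_succ e2
  have e4 := posMoment_two_lindleyLaw_ne_top hr hη h2 (n + 1)
  have e5 := posMoment_ne_top_of_succ e4
  simp only [lindleyLaw] at e4 e5 ⊢
  rwa [ENNReal.toReal_add e4 (by finiteness), ENNReal.toReal_add (by finiteness) h2,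
    ENNReal.toReal_add e2 (by finiteness), ENNReal.toReal_mul, ENNReal.toReal_mul,
    ENNReal.toReal_mul, ENNReal.toReal_ofReal (by positivity), ENNReal.toReal_ofNat] at h

lemma toReal_posMoment_three_lindleyLaw (hr : 0 < r) [IsProbabilityMeasure η]
    (hη : ∀ᵐ x ∂η, 0 ≤ x) (h3 : posMoment 3 η ≠ ⊤) (n : ℕ) :
    (posMoment 3 (lindleyLaw r η (n + 1))).toReal +
      3 / r * (posMoment 2 (lindleyLaw r η (n + 1))).toReal =
      (posMoment 3 (lindleyLaw r η n)).toReal +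
        3 * (posMoment 1 η).toReal * (posMoment 2 (lindleyLaw r η n)).toReal +
        3 * (posMoment 2 η).toReal * (posMoment 1 (lindleyLaw r η n)).toReal +
        (posMoment 3 η).toReal := by
  have := isProbabilityMeasure_lindleyLaw (η := η) hr n
  have := isProbabilityMeasure_lindleyLaw (η := η) hr (n + 1)
  have h := congrArg ENNReal.toReal
    (posMoment_three_lindleyStep hr hη (ae_nonneg_lindleyLaw (r := r) (η := η) n))
  have e0 := posMoment_ne_top_of_succ h3
  have e1 := posMoment_ne_top_of_succ e0
  have e2 := posMoment_three_lindleyLaw_ne_top hr hη h3 n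
  have e3 := posMoment_ne_top_of_succ e2
  have e4 := posMoment_ne_top_of_succ e3
  have e5 := posMoment_three_lindleyLaw_ne_top hr hη h3 (n + 1)
  have e6 := posMoment_ne_top_of_succ e5
  simp only [lindleyLaw] at e5 e6 ⊢
  rwa [ENNReal.toReal_add e5 (by finiteness), ENNReal.toReal_add (by finiteness) h3,
    ENNReal.toReal_add (by finiteness) (by finiteness),
    ENNReal.toReal_add e2 (by finiteness), ENNReal.toReal_mul, ENNReal.toReal_mul,
    ENNReal.toReal_mul, ENNReal.toReal_mul, ENNReal.toReal_mul,
    ENNReal.toReal_ofReal (by positivity), ENNReal.toReal_ofNat] at h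

lemma monotone_posMoment_lindleyLaw (hr : 0 < r) [IsProbabilityMeasure η] (k : ℕ)
    (hfin : ∀ n, posMoment k (lindleyLaw r η n) ≠ ⊤) :
    Monotone fun n => (posMoment k (lindleyLaw r η n)).toReal :=
  monotone_nat_of_le_succ fun n =>
    ENNReal.toReal_mono (hfin _) ((lindleyLaw_le_succ hr n).posMoment_le k)

lemma posMoment_one_lindleyLaw_ne_top (hr : 0 < r) [IsProbabilityMeasure η]
    (hη : ∀ᵐ x ∂η, 0 ≤ x) (h2 : posMoment 2 η ≠ ⊤) (n : ℕ) :
    posMoment 1 (lindleyLaw r η n) ≠ ⊤ := by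
  have := isProbabilityMeasure_lindleyLaw (η := η) hr n
  exact posMoment_ne_top_of_succ (posMoment_two_lindleyLaw_ne_top hr hη h2 n)

/-- By monotonicity in n, replacing n + 1 by n can only decrease the left side of the second-moment
identity. The second moments then cancel, and stability lets the inequality be solved for the first
moment. -/
lemma posMoment_one_lindleyLaw_le (hr : 0 < r) [IsProbabilityMeasure η]
    (hη : ∀ᵐ x ∂η, 0 ≤ x) (h2 : posMoment 2 η ≠ ⊤) (hstab : r * (posMoment 1 η).toReal < 1)
    (n : ℕ) :
    (posMoment 1 (lindleyLaw r η n)).toReal ≤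
      r * (posMoment 2 η).toReal / (2 * (1 - r * (posMoment 1 η).toReal)) := by
  have h := toReal_posMoment_two_lindleyLaw hr hη h2 n
  have m2 := monotone_posMoment_lindleyLaw hr 2 (posMoment_two_lindleyLaw_ne_top hr hη h2)
    (Nat.le_succ n)
  have m1 := monotone_posMoment_lindleyLaw hr 1 (posMoment_one_lindleyLaw_ne_top hr hη h2)
    (Nat.le_succ n)
  simp only [Nat.succ_eq_add_one] at m1 m2
  have m1' := mul_le_mul_of_nonneg_left m1 (show 0 ≤ 2 / r by positivity)
  rw [le_div_iff₀ (by linarith)]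
  have e : 2 / r * r = 2 := by field_simp
  have key : 2 / r * (posMoment 1 (lindleyLaw r η n)).toReal ≤
      2 * (posMoment 1 η).toReal * (posMoment 1 (lindleyLaw r η n)).toReal +
        (posMoment 2 η).toReal := by linarith
  have key' := mul_le_mul_of_nonneg_left key hr.le
  have : r * (2 / r * (posMoment 1 (lindleyLaw r η n)).toReal) =
    2 * (posMoment 1 (lindleyLaw r η n)).toReal := by field_simp
  linarith

/-- The mean workload converges to its stationary value if the service law has a third moment. -/
lemma tendsto_posMoment_one_lindleyLaw_of_three (hr : 0 < r) [IsProbabilityMeasure η]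
    (hη : ∀ᵐ x ∂η, 0 ≤ x) (h3 : posMoment 3 η ≠ ⊤) (hstab : r * (posMoment 1 η).toReal < 1) :
    Tendsto (fun n => (posMoment 1 (lindleyLaw r η n)).toReal) atTop
      (𝓝 (r * (posMoment 2 η).toReal / (2 * (1 - r * (posMoment 1 η).toReal)))) := by
  have h2 := posMoment_ne_top_of_succ h3
  set v := r * (posMoment 2 η).toReal / (2 * (1 - r * (posMoment 1 η).toReal)) with hv
  have M1 := monotone_posMoment_lindleyLaw hr 1 (posMoment_one_lindleyLaw_ne_top hr hη h2)
  have M2 := monotone_posMoment_lindleyLaw hr 2 (posMoment_two_lindleyLaw_ne_top hr hη h2)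
  have M3 := monotone_posMoment_lindleyLaw hr 3 (posMoment_three_lindleyLaw_ne_top hr hη h3)
  have B1 := posMoment_one_lindleyLaw_le hr hη h2 hstab
  -- The argument of `posMoment_one_lindleyLaw_le` one moment higher, with the first moment bounded
  -- by v.
  have B2 : ∀ n, (posMoment 2 (lindleyLaw r η n)).toReal ≤
      r * (3 * (posMoment 2 η).toReal * v + (posMoment 3 η).toReal) /
        (3 * (1 - r * (posMoment 1 η).toReal)) := by
    intro n
    have h := toReal_posMoment_three_lindleyLaw hr hη h3 n
    have m3 := M3 (Nat.le_succ n)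
    have m2 := M2 (Nat.le_succ n)
    simp only [Nat.succ_eq_add_one] at m2 m3
    have m2' := mul_le_mul_of_nonneg_left m2 (show 0 ≤ 3 / r by positivity)
    have m1' := mul_le_mul_of_nonneg_left (B1 n)
      (show 0 ≤ 3 * (posMoment 2 η).toReal by positivity)
    rw [le_div_iff₀ (by linarith)]
    have key : 3 / r * (posMoment 2 (lindleyLaw r η n)).toReal ≤
        3 * (posMoment 1 η).toReal * (posMoment 2 (lindleyLaw r η n)).toReal +
        (3 * (posMoment 2 η).toReal * v + (posMoment 3 η).toReal) := by linarith
    have key' := mul_le_mul_of_nonneg_left key hr.le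
    have : r * (3 / r * (posMoment 2 (lindleyLaw r η n)).toReal) =
      3 * (posMoment 2 (lindleyLaw r η n)).toReal := by field_simp
    linarith
  have T1 := tendsto_atTop_ciSup M1 ⟨_, forall_mem_range.2 B1⟩
  have T2 := tendsto_atTop_ciSup M2 ⟨_, forall_mem_range.2 B2⟩
  set l1 := ⨆ n, (posMoment 1 (lindleyLaw r η n)).toReal
  set l2 := ⨆ n, (posMoment 2 (lindleyLaw r η n)).toReal
  -- The finite limit l2 stands on both sides and cancels; its finiteness is what the third moment
  -- is needed for.
  have hlim : l2 + 2 / r * l1 =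
      l2 + 2 * (posMoment 1 η).toReal * l1 + (posMoment 2 η).toReal := by
    refine tendsto_nhds_unique (((tendsto_add_atTop_iff_nat 1).2 T2).add
      (((tendsto_add_atTop_iff_nat 1).2 T1).const_mul (2 / r))) ?_
    simp_rw [toReal_posMoment_two_lindleyLaw hr hη h2]
    exact (T2.add (T1.const_mul _)).add_const _
  have hl1 : l1 = v := by
    rw [hv, eq_div_iff (by linarith)]
    have h : r * (l2 + 2 / r * l1) = _ := congrArg (r * ·) hlim
    have e : r * (2 / r * l1) = 2 * l1 := by field_simp
    linarith
  rwa [hl1] at T1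

lemma posMoment_map_min (k : ℕ) (η : Measure ℝ) (L : ℝ) :
    posMoment k (η.map fun x => min x L) = ∫⁻ x, ENNReal.ofReal (min x L) ^ k ∂η :=
  lintegral_map (by fun_prop) (by fun_prop)

lemma tendsto_posMoment_map_min (k : ℕ) (η : Measure ℝ) :
    Tendsto (fun L : ℕ => posMoment k (η.map fun x => min x L)) atTop (𝓝 (posMoment k η)) := by
  simp_rw [posMoment_map_min]
  refine lintegral_tendsto_of_tendsto_of_monotone (fun L => by fun_prop)
    (Eventually.of_forall fun x L L' h => ?_) (Eventually.of_forall fun x => ?_)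
  · exact pow_le_pow_left' (ENNReal.ofReal_le_ofReal
      (min_le_min le_rfl (by exact_mod_cast h))) k
  · obtain ⟨N, hN⟩ := exists_nat_ge x
    refine tendsto_const_nhds.congr' ((eventually_ge_atTop N).mono fun L hL => ?_)
    have : x ≤ L := hN.trans (by exact_mod_cast hL)
    simp [this]

/-- The Pollaczek–Khinchine mean value formula, for arrival epochs. -/
theorem tendsto_posMoment_one_lindleyLaw (hr : 0 < r) [IsProbabilityMeasure η]
    (hη : ∀ᵐ x ∂η, 0 ≤ x) (h2 : posMoment 2 η ≠ ⊤) (hstab : r * (posMoment 1 η).toReal < 1) :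
    Tendsto (fun n => (posMoment 1 (lindleyLaw r η n)).toReal) atTop
      (𝓝 (r * (posMoment 2 η).toReal / (2 * (1 - r * (posMoment 1 η).toReal)))) := by
  have h1 := posMoment_ne_top_of_succ h2
  have hprob : ∀ L : ℕ, IsProbabilityMeasure (η.map fun x => min x (L : ℝ)) := fun L =>
    Measure.isProbabilityMeasure_map (by fun_prop)
  have hle : ∀ L : ℕ, StochLE (η.map fun x => min x (L : ℝ)) η := fun L f hf => by
    rw [lintegral_map hf.measurable (by fun_prop)]
    exact lintegral_mono fun x => hf (min_le_left _ _)
  have T1 := (ENNReal.tendsto_toReal h1).comp (tendsto_posMoment_map_min 1 η)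
  have T2 := (ENNReal.tendsto_toReal h2).comp (tendsto_posMoment_map_min 2 η)
  have T : Tendsto (fun L : ℕ => r * (posMoment 2 (η.map fun x => min x (L : ℝ))).toReal /
      (2 * (1 - r * (posMoment 1 (η.map fun x => min x (L : ℝ))).toReal))) atTop
      (𝓝 (r * (posMoment 2 η).toReal / (2 * (1 - r * (posMoment 1 η).toReal)))) :=
    (T2.const_mul r).div (((T1.const_mul r).const_sub 1).const_mul 2) (by linarith)
  -- The upper bound holds at every n without a third moment. For the lower bound, truncate service
  -- at a level L whose limiting mean already exceeds a; the truncated queue lies stochastically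
  -- below.
  refine tendsto_order.2 ⟨fun a ha => ?_, fun a ha => Eventually.of_forall fun n =>
    (posMoment_one_lindleyLaw_le hr hη h2 hstab n).trans_lt ha⟩
  obtain ⟨L, hL⟩ := ((tendsto_order.1 T).1 a ha).exists
  have h3L : posMoment 3 (η.map fun x => min x (L : ℝ)) ≠ ⊤ := by
    rw [posMoment_map_min]
    refine ne_top_of_le_ne_top (b := ∫⁻ _, (L : ℝ≥0∞) ^ 3 ∂η) (by simp) (lintegral_mono fun x => ?_)
    refine pow_le_pow_left' ((ENNReal.ofReal_le_ofReal (min_le_right _ _)).trans ?_) 3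
    simp
  have hηL : ∀ᵐ x ∂(η.map fun x => min x (L : ℝ)), 0 ≤ x :=
    (ae_map_iff (by fun_prop) measurableSet_Ici).2
      (hη.mono fun x hx => le_min hx (Nat.cast_nonneg L))
  have hstabL : r * (posMoment 1 (η.map fun x => min x (L : ℝ))).toReal < 1 :=
    (mul_le_mul_of_nonneg_left (ENNReal.toReal_mono h1 ((hle L).posMoment_le 1)) hr.le).trans_lt
      hstab
  have TL := tendsto_posMoment_one_lindleyLaw_of_three hr hηL h3L hstabL
  filter_upwards [(tendsto_order.1 TL).1 a hL] with n hn
  exact hn.trans_le (ENNReal.toReal_mono (posMoment_one_lindleyLaw_ne_top hr hη h2 n)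
    ((lindleyLaw_mono_service hr (hle L) n).posMoment_le 1))

end

/-! ### Delayed busy periods by first-step analysis -/

/-- Expectation of `f` at the work remaining at the next arrival, on the event that the work `x` is
not finished before that arrival; the new work has law `η`. -/
noncomputable def busyOp (r : ℝ) (η : Measure ℝ) (f : ℝ → ℝ≥0∞) (x : ℝ) : ℝ≥0∞ :=
  ∫⁻ a, (Iio x).indicator (fun a => ∫⁻ b, f (x - a + b) ∂η) a ∂expMeasure r

section

variable {r : ℝ} {η : Measure ℝ} {f g : ℝ → ℝ≥0∞}

lemma measurable_indicator_lintegral_shift [IsProbabilityMeasure η] (hf : Measurable f) :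
    Measurable fun p : ℝ × ℝ => (Iio p.1).indicator (fun a => ∫⁻ b, f (p.1 - a + b) ∂η) p.2 := by
  have h : Measurable fun p : ℝ × ℝ => ∫⁻ b, f (p.1 - p.2 + b) ∂η :=
    Measurable.lintegral_prod_right' (f := fun q : (ℝ × ℝ) × ℝ => f (q.1.1 - q.1.2 + q.2))
      (by fun_prop)
  exact Measurable.ite (measurableSet_lt measurable_snd measurable_fst) h measurable_const

lemma measurable_busyOp (hr : 0 < r) [IsProbabilityMeasure η] (hf : Measurable f) :
    Measurable (busyOp r η f) := by
  have := isProbabilityMeasure_expMeasure hr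
  exact (measurable_indicator_lintegral_shift hf).lintegral_prod_right'

lemma busyOp_congr (hη : ∀ᵐ b ∂η, 0 ≤ b) (h : ∀ y, 0 ≤ y → f y = g y) (x : ℝ) :
    busyOp r η f x = busyOp r η g x := by
  refine lintegral_congr fun a => ?_
  by_cases ha : a < x
  · simp only [mem_Iio, ha, indicator_of_mem]
    exact lintegral_congr_ae (hη.mono fun b hb => h _ (by linarith))
  · simp [ha]

lemma busyOp_add [IsProbabilityMeasure η] (hf : Measurable f) (x : ℝ) :
    busyOp r η (fun y => f y + g y) x = busyOp r η f x + busyOp r η g x := by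
  have hm : Measurable fun a => (Iio x).indicator (fun a => ∫⁻ b, f (x - a + b) ∂η) a :=
    (measurable_indicator_lintegral_shift (η := η) hf).comp
      (measurable_const.prodMk measurable_id : Measurable fun a : ℝ => (x, a))
  rw [busyOp, busyOp, busyOp, ← lintegral_add_left hm]
  refine lintegral_congr fun a => ?_
  by_cases ha : a < x
  · simp only [mem_Iio, ha, indicator_of_mem]
    exact lintegral_add_left (by fun_prop) _
  · simp [ha]

lemma busyOp_const_mul [IsProbabilityMeasure η] (c : ℝ≥0∞) (hf : Measurable f) (x : ℝ) :
    busyOp r η (fun y => c * f y) x = c * busyOp r η f x := by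
  have hm : Measurable fun a => (Iio x).indicator (fun a => ∫⁻ b, f (x - a + b) ∂η) a :=
    (measurable_indicator_lintegral_shift (η := η) hf).comp
      (measurable_const.prodMk measurable_id : Measurable fun a : ℝ => (x, a))
  rw [busyOp, busyOp, ← lintegral_const_mul _ hm]
  refine lintegral_congr fun a => ?_
  by_cases ha : a < x
  · simp only [mem_Iio, ha, indicator_of_mem]
    exact lintegral_const_mul _ (by fun_prop)
  · simp [ha]

/-- Probability that the next arrival comes before time `x`. -/
noncomputable def arrivalProb (r x : ℝ) : ℝ≥0∞ := expMeasure r (Iio x)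

lemma lintegral_indicator_arrivalProb (x : ℝ) :
    ∫⁻ a, (Iio x).indicator (fun _ => 1) a ∂expMeasure r = arrivalProb r x := by
  rw [lintegral_indicator_const measurableSet_Iio, one_mul, arrivalProb]

lemma lintegral_ofReal_sub_add (hr : 0 < r) (x : ℝ) :
    ∫⁻ a, ENNReal.ofReal (x - a) ∂expMeasure r + ENNReal.ofReal (1 / r) * arrivalProb r x =
      ENNReal.ofReal x := by
  have h := lintegral_expMeasure_pow hr 0 x
  simp only [zero_add, pow_one, pow_zero, Nat.cast_zero] at h
  rwa [lintegral_indicator_arrivalProb] at h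

lemma lintegral_ofReal_sub_ne_top (hr : 0 < r) (x : ℝ) :
    ∫⁻ a, ENNReal.ofReal (x - a) ∂expMeasure r ≠ ⊤ :=
  ne_top_of_le_ne_top ENNReal.ofReal_ne_top (le_self_add.trans (lintegral_ofReal_sub_add hr x).le)

lemma lintegral_ofReal_sub_sq_add (hr : 0 < r) (x : ℝ) :
    ∫⁻ a, ENNReal.ofReal (x - a) ^ 2 ∂expMeasure r +
      ENNReal.ofReal (2 / r) * ∫⁻ a, ENNReal.ofReal (x - a) ∂expMeasure r =
      ENNReal.ofReal x ^ 2 := by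
  have h := lintegral_expMeasure_pow hr 1 x
  rw [Nat.cast_one, one_add_one_eq_two, one_add_one_eq_two] at h
  rw [← h]
  congr 2
  refine lintegral_congr fun a => ?_
  by_cases ha : a < x
  · simp [ha]
  · simp [ha, ENNReal.ofReal_of_nonpos (show x - a ≤ 0 by linarith)]

/-- The mean elapsed time in the first-step recursion. It follows from (x - a)⁺ + min x a = x by
cancelling the finite mean of (x - a)⁺. -/
lemma lintegral_ofReal_min (hr : 0 < r) (x : ℝ) :
    ∫⁻ a, ENNReal.ofReal (min x a) ∂expMeasure r = ENNReal.ofReal (1 / r) * arrivalProb r x := by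
  have := isProbabilityMeasure_expMeasure hr
  refine (ENNReal.add_right_inj (lintegral_ofReal_sub_ne_top hr x)).1 ?_
  rw [lintegral_ofReal_sub_add hr, ← lintegral_add_left (by fun_prop)]
  have h : ∀ᵐ a ∂expMeasure r, ENNReal.ofReal (x - a) + ENNReal.ofReal (min x a) =
      ENNReal.ofReal x := by
    filter_upwards [ae_nonneg_expMeasure] with a ha
    rcases le_total x a with h | h
    · simp [ENNReal.ofReal_of_nonpos (show x - a ≤ 0 by linarith), h]
    · rw [min_eq_right h, ← ENNReal.ofReal_add (by linarith) ha, sub_add_cancel]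
  rw [lintegral_congr_ae h, lintegral_const, measure_univ, mul_one]

lemma busyOp_ofReal [IsProbabilityMeasure η] (hη : ∀ᵐ b ∂η, 0 ≤ b) (x : ℝ) :
    busyOp r η ENNReal.ofReal x =
      ∫⁻ a, ENNReal.ofReal (x - a) ∂expMeasure r + posMoment 1 η * arrivalProb r x := by
  rw [busyOp, ← lintegral_indicator_arrivalProb,
    ← lintegral_const_mul _ (measurable_const.indicator measurableSet_Iio),
    ← lintegral_add_left (by fun_prop)]
  refine lintegral_congr fun a => ?_
  by_cases ha : a < x
  · simp only [mem_Iio, ha, indicator_of_mem, mul_one]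
    rw [lintegral_congr_ae (g := fun b => ENNReal.ofReal (x - a) + ENNReal.ofReal b ^ 1)
      (hη.mono fun b hb => by simp [ENNReal.ofReal_add (show 0 ≤ x - a by linarith) hb]),
      lintegral_add_left measurable_const, lintegral_const, measure_univ, mul_one]
    rfl
  · simp [ha, ENNReal.ofReal_of_nonpos (show x - a ≤ 0 by linarith)]

lemma busyOp_ofReal_sq [IsProbabilityMeasure η] (hη : ∀ᵐ b ∂η, 0 ≤ b) (x : ℝ) :
    busyOp r η (fun y => ENNReal.ofReal y ^ 2) x =
      ∫⁻ a, ENNReal.ofReal (x - a) ^ 2 ∂expMeasure r +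
        2 * posMoment 1 η * ∫⁻ a, ENNReal.ofReal (x - a) ∂expMeasure r +
        posMoment 2 η * arrivalProb r x := by
  rw [busyOp, ← lintegral_indicator_arrivalProb,
    ← lintegral_const_mul _ (measurable_const.indicator measurableSet_Iio),
    ← lintegral_const_mul _ (by fun_prop),
    ← lintegral_add_left (by fun_prop), ← lintegral_add_left (by fun_prop)]
  refine lintegral_congr fun a => ?_
  by_cases ha : a < x
  · simp only [mem_Iio, ha, indicator_of_mem, mul_one]
    rw [lintegral_congr_ae (g := fun b => ENNReal.ofReal (x - a) ^ 2 +
      2 * ENNReal.ofReal (x - a) * ENNReal.ofReal b ^ 1 + ENNReal.ofReal b ^ 2)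
      (hη.mono fun b hb => by
        simp only [ENNReal.ofReal_add (show 0 ≤ x - a by linarith) hb]; ring),
      lintegral_add_right _ (by fun_prop), lintegral_add_right _ (by fun_prop),
      lintegral_const_mul _ (by fun_prop), lintegral_const, measure_univ, mul_one]
    simp only [posMoment]
    ring
  · simp [ha, ENNReal.ofReal_of_nonpos (show x - a ≤ 0 by linarith)]

lemma measurable_busyOp_iterate (hr : 0 < r) [IsProbabilityMeasure η] (hf : Measurable f) (k : ℕ) :
    Measurable ((busyOp r η)^[k] f) := by
  induction k with
  | zero => exact hf
  | succ k ih =>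
    rw [Function.iterate_succ_apply']
    exact measurable_busyOp hr ih

/-- The quadratic function `U` with `busyOp U + id = U`. -/
noncomputable def busyPotential (r : ℝ) (η : Measure ℝ) (x : ℝ) : ℝ≥0∞ :=
  ENNReal.ofReal (r / (2 * (1 - r * (posMoment 1 η).toReal))) * ENNReal.ofReal x ^ 2 +
  ENNReal.ofReal ((1 + r * (r / (2 * (1 - r * (posMoment 1 η).toReal))) * (posMoment 2 η).toReal) /
    (1 - r * (posMoment 1 η).toReal)) * ENNReal.ofReal x

lemma busyOp_busyPotential (hr : 0 < r) [IsProbabilityMeasure η] (hη : ∀ᵐ b ∂η, 0 ≤ b)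
    (h2 : posMoment 2 η ≠ ⊤) (hstab : r * (posMoment 1 η).toReal < 1) (x : ℝ) :
    busyOp r η (busyPotential r η) x + ENNReal.ofReal x = busyPotential r η x := by
  have h1 := posMoment_ne_top_of_succ h2
  unfold busyPotential
  rw [busyOp_add (by fun_prop), busyOp_const_mul _ (by fun_prop),
    busyOp_const_mul _ (by fun_prop), busyOp_ofReal hη, busyOp_ofReal_sq hη,
    ← lintegral_ofReal_sub_sq_add hr x]
  simp only [← lintegral_ofReal_sub_add hr x]
  have e1 : posMoment 1 η = ENNReal.ofReal (posMoment 1 η).toReal := (ENNReal.ofReal_toReal h1).symm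
  have e2 : posMoment 2 η = ENNReal.ofReal (posMoment 2 η).toReal := (ENNReal.ofReal_toReal h2).symm
  have hb1 : 0 ≤ (posMoment 1 η).toReal := ENNReal.toReal_nonneg
  have hb2 : 0 ≤ (posMoment 2 η).toReal := ENNReal.toReal_nonneg
  set b1 := (posMoment 1 η).toReal
  set b2 := (posMoment 2 η).toReal
  rw [e1, e2]
  have hd : 0 < 1 - r * b1 := by linarith
  set α := r / (2 * (1 - r * b1)) with hα
  set β := (1 + r * α * b2) / (1 - r * b1) with hβ
  have hα0 : 0 ≤ α := by positivity
  have hβ0 : 0 ≤ β := by positivity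
  generalize ∫⁻ a, ENNReal.ofReal (x - a) ^ 2 ∂expMeasure r = P2
  generalize ∫⁻ a, ENNReal.ofReal (x - a) ∂expMeasure r = P1
  generalize arrivalProb r x = G
  -- Matching the coefficients of P1 determines α, and matching those of G (`c2`) determines β.
  have c1 : ENNReal.ofReal α * (2 * ENNReal.ofReal b1) + 1 =
      ENNReal.ofReal α * ENNReal.ofReal (2 / r) := by
    rw [← ENNReal.ofReal_ofNat 2, ← ENNReal.ofReal_one, ← ENNReal.ofReal_mul (by positivity),
      ← ENNReal.ofReal_mul hα0, ← ENNReal.ofReal_mul hα0,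
      ← ENNReal.ofReal_add (by positivity) (by positivity)]
    congr 1
    rw [hα]
    field_simp
    ring
  have c2 : ENNReal.ofReal α * ENNReal.ofReal b2 + ENNReal.ofReal β * ENNReal.ofReal b1 +
      ENNReal.ofReal (1 / r) = ENNReal.ofReal β * ENNReal.ofReal (1 / r) := by
    rw [← ENNReal.ofReal_mul hα0, ← ENNReal.ofReal_mul hβ0, ← ENNReal.ofReal_mul hβ0,
      ← ENNReal.ofReal_add (by positivity) (by positivity),
      ← ENNReal.ofReal_add (by positivity) (by positivity)]
    congr 1
    rw [hβ]
    field_simp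
    ring
  calc _ = ENNReal.ofReal α * P2 + (ENNReal.ofReal α * (2 * ENNReal.ofReal b1) + 1) * P1 +
        ENNReal.ofReal β * P1 + (ENNReal.ofReal α * ENNReal.ofReal b2 +
          ENNReal.ofReal β * ENNReal.ofReal b1 + ENNReal.ofReal (1 / r)) * G := by ring
    _ = _ := by rw [c1, c2]; ring

lemma measurable_busyPotential : Measurable (busyPotential r η) := by
  unfold busyPotential
  fun_prop

/-- Telescoping of `busyOp U + id = U`, written without subtraction. -/
lemma sum_busyOp_iterate (hr : 0 < r) [IsProbabilityMeasure η] (hη : ∀ᵐ b ∂η, 0 ≤ b)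
    (h2 : posMoment 2 η ≠ ⊤) (hstab : r * (posMoment 1 η).toReal < 1) (k : ℕ) (x : ℝ) :
    ∑ j ∈ Finset.range k, (busyOp r η)^[j] ENNReal.ofReal x +
      (busyOp r η)^[k] (busyPotential r η) x = busyPotential r η x := by
  have hadd : ∀ k, (busyOp r η)^[k + 1] (busyPotential r η) + (busyOp r η)^[k] ENNReal.ofReal =
      (busyOp r η)^[k] (busyPotential r η) := by
    intro k
    induction k with
    | zero => exact funext fun x => busyOp_busyPotential hr hη h2 hstab x
    | succ k ih =>
      funext y
      have e (g : ℝ → ℝ≥0∞) (j : ℕ) : (busyOp r η)^[j + 1] g = busyOp r η ((busyOp r η)^[j] g) :=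
        Function.iterate_succ_apply' _ _ _
      have hm := measurable_busyOp_iterate (η := η) hr
        (measurable_busyPotential (r := r) (η := η)) (k + 1)
      rw [Pi.add_apply, e _ (k + 1), e ENNReal.ofReal k, ← busyOp_add hm]
      exact (congrFun (congrArg (busyOp r η) ih) y).trans (congrFun (e _ k) y).symm
  induction k with
  | zero => simp
  | succ k ih =>
    rw [← ih, Finset.sum_range_succ, ← hadd k, Pi.add_apply]
    ring

/-- The k-th iterate is the mean work just after the k-th arrival on the event that the server has
not cleared its work before. These means have a sum bounded by the finite potential, so they tend to
0. -/
lemma tendsto_busyOp_iterate (hr : 0 < r) [IsProbabilityMeasure η] (hη : ∀ᵐ b ∂η, 0 ≤ b)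
    (h2 : posMoment 2 η ≠ ⊤) (hstab : r * (posMoment 1 η).toReal < 1) (x : ℝ) :
    Tendsto (fun k => (busyOp r η)^[k] ENNReal.ofReal x) atTop (𝓝 0) := by
  refine ENNReal.tendsto_atTop_zero_of_tsum_ne_top (ne_top_of_le_ne_top
    (b := busyPotential r η x) ?_ ?_)
  · rw [busyPotential]
    finiteness
  · rw [ENNReal.tsum_eq_iSup_nat]
    exact iSup_le fun k => le_self_add.trans (sum_busyOp_iterate hr hη h2 hstab k x).le

/-- Mean length of a delayed busy period, characterized by its first-step recursion. -/
theorem iSup_eq_of_busyOp_recursion (hr : 0 < r) [IsProbabilityMeasure η] (hη : ∀ᵐ b ∂η, 0 ≤ b)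
    (h2 : posMoment 2 η ≠ ⊤) (hstab : r * (posMoment 1 η).toReal < 1) {h : ℕ → ℝ → ℝ≥0∞}
    (hm : ∀ k, Measurable (h k)) (h0 : ∀ x, 0 ≤ x → h 0 x = 0)
    (hsucc : ∀ k x, 0 ≤ x →
      h (k + 1) x = ENNReal.ofReal (1 / r) * arrivalProb r x + busyOp r η (h k) x)
    {x : ℝ} (hx : 0 ≤ x) :
    ⨆ k, h k x = ENNReal.ofReal (1 / (1 - r * (posMoment 1 η).toReal)) * ENNReal.ofReal x := by
  have h1 := posMoment_ne_top_of_succ h2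
  have hd : 0 < 1 - r * (posMoment 1 η).toReal := by linarith
  have hb1 : 0 ≤ (posMoment 1 η).toReal := ENNReal.toReal_nonneg
  set c := 1 / (1 - r * (posMoment 1 η).toReal) with hc
  have hc0 : 0 ≤ c := by positivity
  -- This relation makes x ↦ c x a fixed point of the recursion.
  have hcc : ENNReal.ofReal (1 / r) + ENNReal.ofReal c * posMoment 1 η =
      ENNReal.ofReal c * ENNReal.ofReal (1 / r) := by
    rw [← ENNReal.ofReal_toReal h1, ← ENNReal.ofReal_mul hc0, ← ENNReal.ofReal_mul hc0,
      ← ENNReal.ofReal_add (by positivity) (by positivity)]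
    congr 1
    rw [hc]
    field_simp
    ring
  -- The gap between the fixed point and the k-th approximation is exactly c times the k-th iterate
  -- of `busyOp` on the identity.
  have key : ∀ k x, 0 ≤ x → h k x + ENNReal.ofReal c * (busyOp r η)^[k] ENNReal.ofReal x =
      ENNReal.ofReal c * ENNReal.ofReal x := by
    intro k
    induction k with
    | zero => intro x hx; simp [h0 x hx]
    | succ k ih =>
      intro x hx
      have hmk := measurable_busyOp_iterate (η := η) hr ENNReal.measurable_ofReal k
      rw [hsucc k x hx, Function.iterate_succ_apply', ← busyOp_const_mul _ hmk, add_assoc,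
        ← busyOp_add (hm k), busyOp_congr hη ih,
        busyOp_const_mul _ ENNReal.measurable_ofReal, busyOp_ofReal hη,
        ← lintegral_ofReal_sub_add hr x]
      generalize ∫⁻ a, ENNReal.ofReal (x - a) ∂expMeasure r = P1
      generalize arrivalProb r x = G
      calc _ = ENNReal.ofReal c * P1 +
            (ENNReal.ofReal (1 / r) + ENNReal.ofReal c * posMoment 1 η) * G := by ring
        _ = _ := by rw [hcc]; ring
  refine le_antisymm (iSup_le fun k => le_self_add.trans (key k x hx).le) ?_
  have hT : Tendsto (fun k => (⨆ k, h k x) +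
      ENNReal.ofReal c * (busyOp r η)^[k] ENNReal.ofReal x) atTop (𝓝 (⨆ k, h k x)) := by
    have := (ENNReal.Tendsto.const_mul (tendsto_busyOp_iterate hr hη h2 hstab x)
      (Or.inr (ENNReal.ofReal_ne_top (r := c)))).const_add (⨆ k, h k x)
    simpa using this
  refine ge_of_tendsto' hT fun k => ?_
  rw [← key k x hx]
  gcongr
  exact le_iSup (fun k => h k x) k

end

/-! ### From sample paths to laws -/

/-- The workload just before the `n`-th arrival when customers bring the work `w`. -/
def lindleyPath (w : ℝ × Bool → ℝ) (ω : ℕ → Customer) : ℕ → ℝ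
  | 0 => 0
  | n + 1 => max 0 (lindleyPath w ω n + w (ω n).2 - (ω n).1)

/-- Interarrival times and premium work are nonnegative. -/
def NonnegInputs (ω : ℕ → Customer) : Prop := ∀ n, 0 ≤ (ω n).1 ∧ 0 ≤ premService (ω n)

lemma NonnegInputs.tail {ω : ℕ → Customer} (h : NonnegInputs ω) :
    NonnegInputs fun j => ω (j + 1) := fun n => h (n + 1)

/-- Premium work as a function of service time and class. -/
def premMark (e : ℝ × Bool) : ℝ := if e.2 then e.1 else 0

lemma measurable_premMark : Measurable premMark :=
  Measurable.ite (measurable_snd (measurableSet_singleton true)) measurable_fst measurable_const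

lemma measurable_premService : Measurable premService :=
  measurable_premMark.comp measurable_snd

lemma measurable_ordTime (k : ℕ) :
    Measurable fun p : ℝ × (ℕ → Customer) => ordTime k p.1 p.2 := by
  induction k with
  | zero => exact measurable_const
  | succ k ih =>
    simp only [ordTime]
    have h1 : Measurable fun p : ℝ × (ℕ → Customer) => premService (p.2 1) :=
      measurable_premService.comp (by fun_prop)
    refine Measurable.ite (measurableSet_le measurable_fst (by fun_prop)) measurable_fst
      (Measurable.add (by fun_prop) (ih.comp (f := fun p : ℝ × (ℕ → Customer) =>
        (p.1 - (p.2 0).1 + premService (p.2 1), fun j => p.2 (j + 1))) ?_))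
    exact ((by fun_prop : Measurable fun p : ℝ × (ℕ → Customer) => p.1 - (p.2 0).1).add h1).prodMk
      (by fun_prop)

lemma ordTime_nonneg (k : ℕ) {x : ℝ} {ω : ℕ → Customer} (hx : 0 ≤ x) (hω : NonnegInputs ω) :
    0 ≤ ordTime k x ω := by
  induction k generalizing x ω with
  | zero => exact le_rfl
  | succ k ih =>
    rw [ordTime]
    split_ifs with h
    · exact hx
    · have := (hω 1).2
      exact add_nonneg (hω 0).1 (ih (by linarith) hω.tail)

/-- Observing the system up to a later arrival can only lengthen the recorded time; hence monotone
convergence applies to `ordSojourn`. -/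
lemma ordTime_le_succ (k : ℕ) {x : ℝ} {ω : ℕ → Customer} (hx : 0 ≤ x) (hω : NonnegInputs ω) :
    ordTime k x ω ≤ ordTime (k + 1) x ω := by
  induction k generalizing x ω with
  | zero => exact ordTime_nonneg 1 hx hω
  | succ k ih =>
    rw [ordTime, ordTime]
    split_ifs with h
    · exact le_rfl
    · have := (hω 1).2
      exact add_le_add_right (ih (by linarith) hω.tail) _

/-- Later premium arrivals only add work, so x cannot be finished before time x. This is used to
show that a sojourn is at least the customer's own service time, so that the truncated subtraction
in `ordDelay` is a genuine one. -/
lemma min_sum_le_ordTime (k : ℕ) {x : ℝ} {ω : ℕ → Customer} (hω : NonnegInputs ω) :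
    min x (∑ i ∈ Finset.range k, (ω i).1) ≤ ordTime k x ω := by
  induction k generalizing x ω with
  | zero => simp [ordTime]
  | succ k ih =>
    rw [ordTime, Finset.sum_range_succ']
    split_ifs with h
    · exact min_le_left _ _
    · have h1 := (hω 1).2
      have h2 := ih (x := x - (ω 0).1 + premService (ω 1)) hω.tail
      rcases min_le_iff.1 h2 with h3 | h3
      · exact (min_le_left _ _).trans (by linarith)
      · exact (min_le_right _ _).trans (by linarith)

/-- Only the interarrival time of customer 0 is read, so that customer's mark can be averaged
independently. -/
lemma ordTime_consSeq (k : ℕ) (x a : ℝ) (e e' : ℝ × Bool) (ω : ℕ → Customer) :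
    ordTime k x (consSeq (a, e) ω) = ordTime k x (consSeq (a, e') ω) := by
  cases k <;> rfl

/-- Time until the work `x`, together with all premium work that arrives meanwhile, is finished. -/
noncomputable def ordSojourn (x : ℝ) (ω : ℕ → Customer) : ℝ≥0∞ :=
  ⨆ k, ENNReal.ofReal (ordTime k x ω)

lemma measurable_ordSojourn :
    Measurable fun p : ℝ × (ℕ → Customer) => ordSojourn p.1 p.2 :=
  Measurable.iSup fun k => (measurable_ordTime k).ennreal_ofReal

lemma ofReal_le_ordSojourn {x : ℝ} {ω : ℕ → Customer} (hω : NonnegInputs ω)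
    (hsum : Tendsto (fun n => ∑ i ∈ Finset.range n, (ω i).1) atTop atTop) :
    ENNReal.ofReal x ≤ ordSojourn x ω := by
  obtain ⟨k, hk⟩ := (hsum.eventually_ge_atTop x).exists
  refine le_iSup_of_le k (ENNReal.ofReal_le_ofReal ?_)
  have h := min_sum_le_ordTime k (x := x) hω
  rwa [min_eq_left hk] at h

section

variable {r : ℝ} {κ : Measure (ℝ × Bool)}

/-- Law of the i.i.d. customers with exponential interarrival times and service and class of
law `κ`. -/
noncomputable def arrivalLaw (r : ℝ) (κ : Measure (ℝ × Bool)) : Measure (ℕ → Customer) :=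
  Measure.infinitePi fun _ : ℕ => (expMeasure r).prod κ

lemma lintegral_arrivalLaw_cons (hr : 0 < r) [IsProbabilityMeasure κ]
    {f : (ℕ → Customer) → ℝ≥0∞} (hf : Measurable f) :
    ∫⁻ ω, f ω ∂arrivalLaw r κ =
      ∫⁻ e, ∫⁻ a, ∫⁻ ω, f (consSeq (a, e) ω) ∂arrivalLaw r κ ∂expMeasure r ∂κ := by
  have := isProbabilityMeasure_expMeasure hr
  rw [arrivalLaw, lintegral_infinitePi_cons _ hf, lintegral_prod_symm]
  exact (Measurable.lintegral_prod_right' (hf.comp measurable_consSeq)).aemeasurable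

lemma isProbabilityMeasure_arrivalLaw (hr : 0 < r) [IsProbabilityMeasure κ] :
    IsProbabilityMeasure (arrivalLaw r κ) := by
  have := isProbabilityMeasure_expMeasure hr
  unfold arrivalLaw
  infer_instance

lemma ae_arrivalLaw (hr : 0 < r) [IsProbabilityMeasure κ] {p : Customer → Prop}
    (hp : ∀ᵐ c ∂(expMeasure r).prod κ, p c) : ∀ᵐ ω ∂arrivalLaw r κ, ∀ n, p (ω n) := by
  have := isProbabilityMeasure_expMeasure hr
  exact ae_all_iff.2 fun n =>
    (measurePreserving_eval_infinitePi (fun _ : ℕ => (expMeasure r).prod κ)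
      n).quasiMeasurePreserving.ae hp

lemma ae_nonneg_interarrival [SFinite κ] : ∀ᵐ c ∂(expMeasure r).prod κ, 0 ≤ c.1 :=
  Measure.quasiMeasurePreserving_fst.ae ae_nonneg_expMeasure

lemma ae_nonnegInputs (hr : 0 < r) [IsProbabilityMeasure κ] (hκ : ∀ᵐ e ∂κ, 0 ≤ premMark e) :
    ∀ᵐ ω ∂arrivalLaw r κ, NonnegInputs ω := by
  have := isProbabilityMeasure_expMeasure hr
  exact ae_arrivalLaw hr (ae_nonneg_interarrival.and (Measure.quasiMeasurePreserving_snd.ae hκ))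

/-- Markov property: the workload before arrival n is a function of the earlier customers, hence
independent of the customers from n on, the n-th included. -/
lemma lintegral_lindleyPath (hr : 0 < r) [IsProbabilityMeasure κ] {w : ℝ × Bool → ℝ}
    (hw : Measurable w) (n : ℕ) {f : ℝ × (ℕ → Customer) → ℝ≥0∞} (hf : Measurable f) :
    ∫⁻ ω, f (lindleyPath w ω n, fun j => ω (n + j)) ∂arrivalLaw r κ =
      ∫⁻ v, ∫⁻ ω, f (v, ω) ∂arrivalLaw r κ ∂lindleyLaw r (κ.map w) n := by
  have hexp := isProbabilityMeasure_expMeasure hr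
  have hlaw := isProbabilityMeasure_arrivalLaw (κ := κ) hr
  have hmap : IsProbabilityMeasure (κ.map w) := Measure.isProbabilityMeasure_map hw.aemeasurable
  induction n generalizing f with
  | zero =>
    rw [lindleyLaw, lintegral_dirac' _ hf.lintegral_prod_right']
    simp [lindleyPath]
  | succ n ih =>
    have hn := isProbabilityMeasure_lindleyLaw (η := κ.map w) hr n
    have hF : Measurable fun x => ∫⁻ ω, f (x, ω) ∂arrivalLaw r κ := hf.lintegral_prod_right'
    -- One step of the queue, absorbed into the test function: the induction hypothesis for `f`
    -- after this step is the claim at n + 1.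
    have hψ : Measurable fun p : ℝ × (ℕ → Customer) =>
        (max 0 (p.1 + w (p.2 0).2 - (p.2 0).1), fun j => p.2 (j + 1)) := by fun_prop
    have h := ih (hf.comp hψ)
    simp only [Function.comp_apply] at h
    rw [lindleyLaw, lintegral_lindleyStep hr hF]
    have e : ∀ (ω : ℕ → Customer), (fun j => ω (n + 1 + j)) = fun j => ω (n + (j + 1)) :=
      fun ω => funext fun j => by rw [add_right_comm, add_assoc]
    simp only [lindleyPath, e]
    simp only [add_zero] at h
    rw [h]
    refine lintegral_congr fun v => ?_
    have hin : Measurable fun b => ∫⁻ a, (fun x => ∫⁻ ω, f (x, ω) ∂arrivalLaw r κ)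
        (max 0 (v + b - a)) ∂expMeasure r :=
      Measurable.lintegral_prod_right' (f := fun p : ℝ × ℝ =>
        (fun x => ∫⁻ ω, f (x, ω) ∂arrivalLaw r κ) (max 0 (v + p.1 - p.2)))
        (hF.comp (by fun_prop))
    rw [lintegral_map hin hw, lintegral_arrivalLaw_cons hr]
    · rfl
    · exact (hf.comp hψ).comp (by fun_prop : Measurable fun ω : ℕ → Customer => (v, ω))

/-- A functional that depends on the first customer only through the interarrival time is
independent of the service time and class of that customer. -/
lemma lintegral_arrivalLaw_shift (hr : 0 < r) [IsProbabilityMeasure κ] {w : ℝ × Bool → ℝ}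
    (hw : Measurable w) {F : ℝ × (ℕ → Customer) → ℝ≥0∞} (hF : Measurable F)
    (hFc : ∀ x a e e' ω, F (x, consSeq (a, e) ω) = F (x, consSeq (a, e') ω)) (y : ℝ) :
    ∫⁻ ω, F (y + w (ω 0).2, ω) ∂arrivalLaw r κ =
      ∫⁻ e, ∫⁻ ω, F (y + w e, ω) ∂arrivalLaw r κ ∂κ := by
  have hlaw := isProbabilityMeasure_arrivalLaw (κ := κ) hr
  have h1 : ∀ x e₀, ∫⁻ ω, F (x, ω) ∂arrivalLaw r κ =
      ∫⁻ a, ∫⁻ ω, F (x, consSeq (a, e₀) ω) ∂arrivalLaw r κ ∂expMeasure r := by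
    intro x e₀
    rw [lintegral_arrivalLaw_cons hr (f := fun ω => F (x, ω)) (by fun_prop)]
    simp_rw [hFc x _ _ e₀]
    rw [lintegral_const, measure_univ, mul_one]
  rw [lintegral_arrivalLaw_cons hr (f := fun ω => F (y + w (ω 0).2, ω)) (by fun_prop)]
  refine lintegral_congr fun e => ?_
  rw [h1 _ e]
  rfl

/-- Strong law for the interarrival times cut off at 1, which are integrable because bounded and
still have positive mean. -/
lemma ae_tendsto_sum_interarrival (hr : 0 < r) [IsProbabilityMeasure κ] :
    ∀ᵐ ω ∂arrivalLaw r κ,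
      Tendsto (fun n => ∑ i ∈ Finset.range n, (ω i).1) atTop atTop := by
  have hexp := isProbabilityMeasure_expMeasure hr
  have hlaw := isProbabilityMeasure_arrivalLaw (κ := κ) hr
  set X : ℕ → (ℕ → Customer) → ℝ := fun i ω => min 1 (ω i).1 with hX
  have hXm : ∀ i, Measurable (X i) := fun i => by fun_prop
  have hmin : Measurable fun c : Customer => min 1 c.1 := by fun_prop
  have hnn : ∀ᵐ ω ∂arrivalLaw r κ, ∀ i, 0 ≤ (ω i).1 := ae_arrivalLaw hr ae_nonneg_interarrival
  have hint : Integrable (X 0) (arrivalLaw r κ) := by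
    refine Integrable.of_bound (hXm 0).aestronglyMeasurable 1 (hnn.mono fun ω hω => ?_)
    rw [Real.norm_eq_abs, abs_of_nonneg (le_min zero_le_one (hω 0))]
    exact min_le_left _ _
  have hlawi : ∀ i, (arrivalLaw r κ).map (X i) =
      ((expMeasure r).prod κ).map fun c => min 1 c.1 := fun i => by
    rw [← Measure.infinitePi_map_eval (fun _ : ℕ => (expMeasure r).prod κ) i,
      Measure.map_map hmin (by fun_prop)]
    rfl
  have hident : ∀ i, IdentDistrib (X i) (X 0) (arrivalLaw r κ) (arrivalLaw r κ) := fun i =>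
    ⟨(hXm i).aemeasurable, (hXm 0).aemeasurable, by rw [hlawi, hlawi]⟩
  have hindep : Pairwise (Function.onFun (fun f g => IndepFun f g (arrivalLaw r κ)) X) :=
    fun i j hij => (iIndepFun_infinitePi (P := fun _ : ℕ => (expMeasure r).prod κ)
      (X := fun _ c => min 1 c.1) (fun _ => hmin)).indepFun hij
  have hpos : 0 < ∫ ω, X 0 ω ∂arrivalLaw r κ := by
    have h0 : 0 ≤ᵐ[arrivalLaw r κ] X 0 := hnn.mono fun ω hω => le_min zero_le_one (hω 0)
    rw [integral_eq_lintegral_of_nonneg_ae h0 (hXm 0).aestronglyMeasurable]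
    have hval : ∫⁻ ω, ENNReal.ofReal (X 0 ω) ∂arrivalLaw r κ =
        ENNReal.ofReal (1 / r) * arrivalProb r 1 := by
      rw [← lintegral_ofReal_min hr, lintegral_arrivalLaw_cons hr (by fun_prop)]
      simp [hX]
    have hle := lintegral_ofReal_sub_add hr 1
    rw [hval]
    refine ENNReal.toReal_pos (fun h => ?_) ?_
    · have hz : arrivalProb r 1 = 0 := by
        rcases mul_eq_zero.1 h with h | h
        · exact absurd (ENNReal.ofReal_eq_zero.1 h) (not_le.2 (by positivity))
        · exact h
      -- On a ≥ 0, (1 - a)⁺ is at most the indicator of a < 1. If the latter had mean 0, both terms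
      -- of `lintegral_ofReal_sub_add` at x = 1 would vanish, although their sum is 1.
      have hP : ∫⁻ a, ENNReal.ofReal (1 - a) ∂expMeasure r = 0 := by
        refine le_antisymm ?_ zero_le
        rw [← hz, ← lintegral_indicator_arrivalProb]
        refine lintegral_mono_ae (ae_nonneg_expMeasure.mono fun a ha => ?_)
        by_cases h1 : a < 1
        · simpa [h1] using ha
        · simp [h1, not_lt.1 h1]
      rw [hP, hz] at hle
      simp at hle
    · exact ENNReal.mul_ne_top ENNReal.ofReal_ne_top (measure_ne_top _ _)
  filter_upwards [strong_law_ae_real X hint hindep hident] with ω hω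
  have hmul := hω.pos_mul_atTop hpos tendsto_natCast_atTop_atTop
  refine tendsto_atTop_mono' _ ?_ hmul
  filter_upwards [eventually_gt_atTop 0] with n hn
  have hn' : (n : ℝ) ≠ 0 := by positivity
  rw [div_mul_cancel₀ _ hn']
  exact Finset.sum_le_sum fun i _ => min_le_right _ _

/-- Mean of the time to finish the work `x` under preemption by premium customers. -/
theorem lintegral_ordSojourn (hr : 0 < r) [IsProbabilityMeasure κ]
    (hκ : ∀ᵐ e ∂κ, 0 ≤ premMark e) (h2 : posMoment 2 (κ.map premMark) ≠ ⊤)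
    (hstab : r * (posMoment 1 (κ.map premMark)).toReal < 1) {x : ℝ} (hx : 0 ≤ x) :
    ∫⁻ ω, ordSojourn x ω ∂arrivalLaw r κ =
      ENNReal.ofReal (1 / (1 - r * (posMoment 1 (κ.map premMark)).toReal)) * ENNReal.ofReal x := by
  have hexp := isProbabilityMeasure_expMeasure hr
  have hlaw := isProbabilityMeasure_arrivalLaw (κ := κ) hr
  have hmap : IsProbabilityMeasure (κ.map premMark) :=
    Measure.isProbabilityMeasure_map measurable_premMark.aemeasurable
  have hη : ∀ᵐ b ∂κ.map premMark, 0 ≤ b :=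
    (ae_map_iff measurable_premMark.aemeasurable measurableSet_Ici).2 hκ
  have hgood := ae_nonnegInputs hr hκ
  have hmk : ∀ k, Measurable fun p : ℝ × (ℕ → Customer) => ENNReal.ofReal (ordTime k p.1 p.2) :=
    fun k => (measurable_ordTime k).ennreal_ofReal
  have hmx : ∀ k x, Measurable fun ω => ENNReal.ofReal (ordTime k x ω) :=
    fun k x => (hmk k).comp measurable_prodMk_left
  unfold ordSojourn
  rw [lintegral_iSup' (fun k => (hmx k x).aemeasurable)
    (hgood.mono fun ω hω => monotone_nat_of_le_succ fun k =>
      ENNReal.ofReal_le_ofReal (ordTime_le_succ k hx hω))]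
  refine iSup_eq_of_busyOp_recursion hr hη h2 hstab
    (h := fun k x => ∫⁻ ω, ENNReal.ofReal (ordTime k x ω) ∂arrivalLaw r κ)
    (fun k => (hmk k).lintegral_prod_right') (fun x _ => by simp [ordTime])
    (fun k x hx => ?_) hx
  rw [lintegral_arrivalLaw_cons hr (hmx (k + 1) x),
    ← lintegral_ofReal_min hr, busyOp, ← lintegral_add_left (by fun_prop)]
  have hinner : ∀ e : ℝ × Bool, ∀ᵐ a ∂expMeasure r,
      ∫⁻ ω, ENNReal.ofReal (ordTime (k + 1) x (consSeq (a, e) ω)) ∂arrivalLaw r κ =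
      ENNReal.ofReal (min x a) + (Iio x).indicator (fun a => ∫⁻ b, ∫⁻ ω,
        ENNReal.ofReal (ordTime k (x - a + b) ω) ∂arrivalLaw r κ ∂κ.map premMark) a := by
    intro e
    filter_upwards [ae_nonneg_expMeasure] with a ha
    by_cases hxa : x ≤ a
    · simp [ordTime, hxa]
    · have hax : a < x := not_le.1 hxa
      have hmb : Measurable fun b => ∫⁻ ω, ENNReal.ofReal (ordTime k (x - a + b) ω)
          ∂arrivalLaw r κ :=
        (hmk k).lintegral_prod_right'.comp (by fun_prop : Measurable fun b : ℝ => x - a + b)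
      -- In the tail, `ω 0` is the next customer. Its mark enters the remaining work while `ordTime`
      -- reads only its interarrival time, so the mark may be replaced by an independent copy.
      rw [indicator_of_mem (mem_Iio.2 hax), min_eq_right hax.le,
        lintegral_map hmb measurable_premMark,
        ← lintegral_arrivalLaw_shift hr measurable_premMark (hmk k)
          (fun x a e e' ω => by rw [ordTime_consSeq k x a e e' ω])]
      have hsplit : ∀ᵐ ω ∂arrivalLaw r κ,
          ENNReal.ofReal (ordTime (k + 1) x (consSeq (a, e) ω)) = ENNReal.ofReal a +
            ENNReal.ofReal (ordTime k (x - a + premMark (ω 0).2) ω) := by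
        filter_upwards [hgood] with ω hω
        have h0 : 0 ≤ premMark (ω 0).2 := (hω 0).2
        rw [← ENNReal.ofReal_add ha (ordTime_nonneg k (by linarith) hω), ordTime,
          if_neg (by simpa using hax)]
        rfl
      rw [lintegral_congr_ae hsplit, lintegral_add_left measurable_const, lintegral_const,
        measure_univ, mul_one]
  rw [lintegral_congr fun e => lintegral_congr_ae (hinner e), lintegral_const, measure_univ,
    mul_one]

end

lemma lindleyPath_premMark (ω : ℕ → Customer) (n : ℕ) :
    lindleyPath premMark ω n = premWork ω n := by
  induction n with
  | zero => rfl
  | succ n ih => rw [lindleyPath, premWork, ih]; rfl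

lemma premWork_nonneg (ω : ℕ → Customer) (n : ℕ) : 0 ≤ premWork ω n := by
  cases n with
  | zero => exact le_rfl
  | succ n => exact le_max_left _ _

lemma ordWork_nonneg (ω : ℕ → Customer) (n : ℕ) : 0 ≤ ordWork ω n := by
  cases n with
  | zero => exact le_rfl
  | succ n => exact le_max_left _ _

/-- The total workload does not depend on the order of service. -/
lemma premWork_add_ordWork {ω : ℕ → Customer} (hω : ∀ n, 0 ≤ (ω n).2.1) (n : ℕ) :
    premWork ω n + ordWork ω n = lindleyPath Prod.fst ω n := by
  induction n with
  | zero => simp [premWork, ordWork, lindleyPath]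
  | succ n ih =>
    have h1 := premWork_nonneg ω n
    have h2 := ordWork_nonneg ω n
    have hs : premService (ω n) + ordService (ω n) = (ω n).2.1 := by
      unfold premService ordService
      split_ifs <;> simp
    have ho : 0 ≤ ordService (ω n) := by
      unfold ordService
      split_ifs
      · exact le_rfl
      · exact hω n
    rw [lindleyPath, ← ih, premWork, ordWork, ← hs]
    -- Either premium work lasts until the next arrival and ordinary work is untouched, or the
    -- leftover time goes to ordinary work.
    rcases le_total 0 (premWork ω n + premService (ω n) - (ω n).1) with h | h
    · rw [max_eq_right h, max_eq_left (show (ω n).1 - (premWork ω n + premService (ω n)) ≤ 0 by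
        linarith), max_eq_right (by linarith), max_eq_right (by linarith)]
      ring
    · rw [max_eq_left h, max_eq_right (show 0 ≤ (ω n).1 - (premWork ω n + premService (ω n)) by
        linarith), zero_add]
      congr 1
      ring

/-! ### Steady-state waiting times of the two classes -/

namespace MG1Queue

variable (Q : MG1Queue)

/-- Law of the service time and class of one customer. -/
noncomputable def markLaw (φ : I) : Measure (ℝ × Bool) :=
  Q.service.prod (bernoulliMeasure true false φ)

lemma isProbabilityMeasure_markLaw (φ : I) : IsProbabilityMeasure (Q.markLaw φ) := by
  have := Q.service_prob
  unfold markLaw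
  infer_instance

lemma law_eq (φ : I) : Q.law φ = arrivalLaw Q.lam (Q.markLaw φ) := rfl

lemma markLaw_map_fst (φ : I) : (Q.markLaw φ).map Prod.fst = Q.service := by
  have := Q.service_prob
  rw [markLaw, Measure.map_fst_prod, measure_univ, one_smul]

lemma ae_nonneg_fst_markLaw (φ : I) : ∀ᵐ e ∂Q.markLaw φ, 0 ≤ e.1 := by
  have := Q.service_prob
  exact Measure.quasiMeasurePreserving_fst.ae Q.service_nonneg

lemma ae_nonneg_premMark (φ : I) : ∀ᵐ e ∂Q.markLaw φ, 0 ≤ premMark e :=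
  (Q.ae_nonneg_fst_markLaw φ).mono fun e he => by
    unfold premMark
    split_ifs
    · exact he
    · exact le_rfl

/-- The exponent is positive, so ordinary customers, whose premium work is 0, contribute nothing. -/
lemma posMoment_premMark (φ : I) (k : ℕ) :
    posMoment (k + 1) ((Q.markLaw φ).map premMark) =
      ENNReal.ofReal φ * posMoment (k + 1) Q.service := by
  have := Q.service_prob
  rw [posMoment, lintegral_map (by fun_prop) measurable_premMark, markLaw,
    lintegral_prod _ (by have := measurable_premMark; fun_prop), posMoment,
    ← lintegral_const_mul _ (by fun_prop)]
  refine lintegral_congr fun s => ?_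
  rw [bernoulliMeasure_def, lintegral_add_measure, lintegral_smul_measure, lintegral_smul_measure,
    lintegral_dirac, lintegral_dirac]
  have h : ((unitInterval.toNNReal φ : NNReal) : ℝ≥0∞) = ENNReal.ofReal φ := by
    rw [ENNReal.ofReal, ENNReal.coe_inj]
    exact (Real.toNNReal_of_nonneg φ.2.1).symm
  simp [premMark, ENNReal.smul_def, h]

lemma posMoment_service_two :
    posMoment 2 Q.service = ENNReal.ofReal (∫ s, s ^ 2 ∂Q.service) := by
  rw [ofReal_integral_eq_lintegral_ofReal Q.service_sq_integrable
    (Eventually.of_forall fun s => sq_nonneg s), posMoment]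
  exact lintegral_congr_ae (Q.service_nonneg.mono fun s hs => (ENNReal.ofReal_pow hs 2).symm)

lemma posMoment_service_two_ne_top : posMoment 2 Q.service ≠ ⊤ := by
  rw [posMoment_service_two]
  exact ENNReal.ofReal_ne_top

lemma toReal_posMoment_service_two :
    (posMoment 2 Q.service).toReal = ∫ s, s ^ 2 ∂Q.service := by
  rw [posMoment_service_two, ENNReal.toReal_ofReal (integral_nonneg fun s => sq_nonneg s)]

lemma posMoment_service_one_ne_top : posMoment 1 Q.service ≠ ⊤ := by
  have := Q.service_prob
  exact posMoment_ne_top_of_succ Q.posMoment_service_two_ne_top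

lemma toReal_posMoment_service_one :
    (posMoment 1 Q.service).toReal = ∫ s, s ∂Q.service := by
  rw [integral_eq_lintegral_of_nonneg_ae Q.service_nonneg (by fun_prop)]
  simp [posMoment]

lemma mu_pos : 0 < Q.mu := inv_pos.2 Q.service_mean_pos

lemma mean_eq : ∫ s, s ∂Q.service = 1 / Q.mu := by
  rw [mu, one_div, inv_inv]

lemma sq_eq : ∫ s, s ^ 2 ∂Q.service = Q.K / Q.mu ^ 2 := by
  have := Q.mu_pos
  rw [K]
  field_simp

lemma K_nonneg : 0 ≤ Q.K := mul_nonneg (sq_nonneg _) (integral_nonneg fun s => sq_nonneg s)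

lemma rho_pos : 0 < Q.rho := div_pos Q.lam_pos Q.mu_pos

lemma rho_lt_one : Q.rho < 1 := by
  have h := Q.stable
  rwa [mean_eq, mul_one_div] at h

lemma lam_eq : Q.lam = Q.rho * Q.mu := by
  rw [rho, div_mul_cancel₀ _ Q.mu_pos.ne']

lemma prem_load_lt_one (φ : I) :
    Q.lam * (posMoment 1 ((Q.markLaw φ).map premMark)).toReal < 1 := by
  have h := Q.posMoment_premMark φ 0
  rw [zero_add] at h
  rw [h, ENNReal.toReal_mul, ENNReal.toReal_ofReal φ.2.1, toReal_posMoment_service_one]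
  calc Q.lam * ((φ : ℝ) * ∫ s, s ∂Q.service) = (φ : ℝ) * (Q.lam * ∫ s, s ∂Q.service) := by ring
    _ ≤ 1 * (Q.lam * ∫ s, s ∂Q.service) :=
        mul_le_mul_of_nonneg_right φ.2.2 (mul_pos Q.lam_pos Q.service_mean_pos).le
    _ < 1 := by simpa using Q.stable

lemma prem_load_eq (φ : I) :
    Q.lam * (posMoment 1 ((Q.markLaw φ).map premMark)).toReal = φ * Q.rho := by
  have h := Q.posMoment_premMark φ 0
  rw [zero_add] at h
  rw [h, ENNReal.toReal_mul, ENNReal.toReal_ofReal φ.2.1, toReal_posMoment_service_one, mean_eq,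
    rho]
  ring

lemma posMoment_two_premMark_ne_top (φ : I) :
    posMoment 2 ((Q.markLaw φ).map premMark) ≠ ⊤ := by
  have h := Q.posMoment_premMark φ 1
  rw [one_add_one_eq_two] at h
  rw [h]
  exact ENNReal.mul_ne_top ENNReal.ofReal_ne_top Q.posMoment_service_two_ne_top

lemma premMeanDelay_eq (φ : I) (n : ℕ) :
    Q.premMeanDelay φ n = posMoment 1 (lindleyLaw Q.lam ((Q.markLaw φ).map premMark) n) := by
  have := Q.isProbabilityMeasure_markLaw φ
  have := isProbabilityMeasure_arrivalLaw (κ := Q.markLaw φ) Q.lam_pos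
  have h := lintegral_lindleyPath (κ := Q.markLaw φ) Q.lam_pos measurable_premMark n
    (f := fun p => ENNReal.ofReal p.1) (by fun_prop)
  rw [premMeanDelay, law_eq]
  simp only [lindleyPath_premMark, lintegral_const, measure_univ, mul_one] at h
  simpa [posMoment, premDelay] using h

lemma tendsto_premMeanDelay (φ : I) :
    Tendsto (Q.premMeanDelay φ) atTop
      (𝓝 (ENNReal.ofReal (φ * Q.rho * Q.K / (2 * Q.mu * (1 - φ * Q.rho))))) := by
  have := Q.isProbabilityMeasure_markLaw φ
  have hmap : IsProbabilityMeasure ((Q.markLaw φ).map premMark) :=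
    Measure.isProbabilityMeasure_map measurable_premMark.aemeasurable
  have hη : ∀ᵐ b ∂(Q.markLaw φ).map premMark, 0 ≤ b :=
    (ae_map_iff measurable_premMark.aemeasurable measurableSet_Ici).2 (Q.ae_nonneg_premMark φ)
  have h2 := Q.posMoment_two_premMark_ne_top φ
  have h := ENNReal.tendsto_ofReal
    (tendsto_posMoment_one_lindleyLaw Q.lam_pos hη h2 (Q.prem_load_lt_one φ))
  have hfin := posMoment_one_lindleyLaw_ne_top Q.lam_pos hη h2
  simp only [← premMeanDelay_eq] at h hfin
  simp only [ENNReal.ofReal_toReal (hfin _)] at h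
  convert h using 3
  have e := Q.posMoment_premMark φ 1
  rw [one_add_one_eq_two] at e
  rw [prem_load_eq, e, ENNReal.toReal_mul, ENNReal.toReal_ofReal φ.2.1,
    toReal_posMoment_service_two, sq_eq, lam_eq]
  have := Q.mu_pos
  have h3 := Q.prem_load_lt_one φ
  rw [prem_load_eq] at h3
  have h4 : 1 - (φ : ℝ) * Q.rho ≠ 0 := by linarith
  field_simp

/-- The customer must wait out the total work v found and the own service s, stretched by premium
interruptions to mean (v + s) / (1 - φρ); subtracting the mean of s leaves this expression. -/
lemma ordMeanDelay_eq (φ : I) (n : ℕ) :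
    Q.ordMeanDelay φ n =
      ENNReal.ofReal (1 / (1 - φ * Q.rho)) * posMoment 1 (lindleyLaw Q.lam Q.service n) +
      (ENNReal.ofReal (1 / (1 - φ * Q.rho)) * posMoment 1 Q.service - posMoment 1 Q.service) := by
  have hs := Q.service_prob
  have hmark := Q.isProbabilityMeasure_markLaw φ
  have hlaw := isProbabilityMeasure_arrivalLaw (κ := Q.markLaw φ) Q.lam_pos
  have hload := Q.prem_load_lt_one φ
  have hmean := fun {x : ℝ} (hx : 0 ≤ x) => lintegral_ordSojourn Q.lam_pos
    (Q.ae_nonneg_premMark φ) (Q.posMoment_two_premMark_ne_top φ) hload hx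
  rw [prem_load_eq] at hload
  simp only [prem_load_eq] at hmean
  -- The stretching factor is at least 1, so subtraction in `ℝ≥0∞` loses nothing when the terms are
  -- regrouped.
  have hc1 : 1 ≤ ENNReal.ofReal (1 / (1 - φ * Q.rho)) := by
    rw [ENNReal.one_le_ofReal, le_div_iff₀ (by linarith)]
    have := mul_nonneg φ.2.1 Q.rho_pos.le
    linarith
  set c := ENNReal.ofReal (1 / (1 - φ * Q.rho)) with hc
  have hm : Measurable fun p : ℝ × (ℕ → Customer) =>
      ordSojourn (p.1 + (p.2 0).2.1) p.2 - ENNReal.ofReal (p.2 0).2.1 :=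
    (measurable_ordSojourn.comp (f := fun p : ℝ × (ℕ → Customer) => (p.1 + (p.2 0).2.1, p.2))
      (by fun_prop)).sub (by fun_prop)
  have hserv : ∀ᵐ ω ∂arrivalLaw Q.lam (Q.markLaw φ), ∀ n, 0 ≤ (ω n).2.1 := by
    have := isProbabilityMeasure_expMeasure Q.lam_pos
    exact ae_arrivalLaw Q.lam_pos
      (Measure.quasiMeasurePreserving_snd.ae (Q.ae_nonneg_fst_markLaw φ))
  have hstart : Q.ordMeanDelay φ n = ∫⁻ ω, (fun p : ℝ × (ℕ → Customer) =>
      ordSojourn (p.1 + (p.2 0).2.1) p.2 - ENNReal.ofReal (p.2 0).2.1)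
      (lindleyPath Prod.fst ω n, fun j => ω (n + j)) ∂arrivalLaw Q.lam (Q.markLaw φ) := by
    rw [ordMeanDelay, law_eq]
    refine lintegral_congr_ae (hserv.mono fun ω hω => ?_)
    simp only [ordDelay, premWork_add_ordWork hω, add_zero, ordSojourn]
  rw [hstart, lintegral_lindleyPath Q.lam_pos measurable_fst n hm, markLaw_map_fst]
  have hinner : ∀ᵐ v ∂lindleyLaw Q.lam Q.service n,
      ∫⁻ ω, (ordSojourn (v + (ω 0).2.1) ω - ENNReal.ofReal (ω 0).2.1)
        ∂arrivalLaw Q.lam (Q.markLaw φ) =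
      c * ENNReal.ofReal v ^ 1 + (c * posMoment 1 Q.service - posMoment 1 Q.service) := by
    filter_upwards [ae_nonneg_lindleyLaw n] with v hv
    have hS : ∫⁻ ω, ENNReal.ofReal (ω 0).2.1 ∂arrivalLaw Q.lam (Q.markLaw φ) =
        posMoment 1 Q.service := by
      have := isProbabilityMeasure_expMeasure Q.lam_pos
      rw [lintegral_arrivalLaw_cons Q.lam_pos (by fun_prop), ← Q.markLaw_map_fst φ, posMoment,
        lintegral_map (by fun_prop) measurable_fst]
      simp
    have hle : (fun ω : ℕ → Customer => ENNReal.ofReal (ω 0).2.1)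
        ≤ᵐ[arrivalLaw Q.lam (Q.markLaw φ)] fun ω => ordSojourn (v + (ω 0).2.1) ω := by
      filter_upwards [ae_nonnegInputs Q.lam_pos (Q.ae_nonneg_premMark φ),
        ae_tendsto_sum_interarrival Q.lam_pos] with ω h1 h2
      exact (ENNReal.ofReal_le_ofReal (by linarith)).trans (ofReal_le_ordSojourn h1 h2)
    have hT : ∫⁻ ω, ordSojourn (v + (ω 0).2.1) ω ∂arrivalLaw Q.lam (Q.markLaw φ) =
        c * ENNReal.ofReal v + c * posMoment 1 Q.service := by
      rw [lintegral_arrivalLaw_shift Q.lam_pos measurable_fst measurable_ordSojourn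
        (fun x a e e' ω => by simp only [ordSojourn, ordTime_consSeq _ x a e e' ω]) v]
      have h : ∀ᵐ e ∂Q.markLaw φ, ∫⁻ ω, ordSojourn (v + e.1) ω ∂arrivalLaw Q.lam (Q.markLaw φ) =
          c * ENNReal.ofReal v + c * ENNReal.ofReal e.1 ^ 1 := by
        filter_upwards [Q.ae_nonneg_fst_markLaw φ] with e he
        rw [hmean (add_nonneg hv he), ENNReal.ofReal_add hv he, mul_add, pow_one]
      rw [lintegral_congr_ae h, lintegral_add_left measurable_const, lintegral_const,
        measure_univ, mul_one, lintegral_const_mul _ (by fun_prop)]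
      conv_rhs => rw [← Q.markLaw_map_fst φ, posMoment, lintegral_map (by fun_prop) measurable_fst]
    rw [lintegral_sub (by fun_prop) (by rw [hS]; exact Q.posMoment_service_one_ne_top) hle, hS, hT,
      pow_one]
    exact (ENNReal.cancel_of_ne Q.posMoment_service_one_ne_top).add_tsub_assoc_of_le
      (le_mul_of_one_le_left zero_le hc1) _
  have hμ := isProbabilityMeasure_lindleyLaw (η := Q.service) Q.lam_pos n
  rw [lintegral_congr_ae hinner, lintegral_add_right _ measurable_const, lintegral_const,
    measure_univ, mul_one, lintegral_const_mul _ (by fun_prop)]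
  rfl

lemma tendsto_ordMeanDelay (φ : I) :
    Tendsto (Q.ordMeanDelay φ) atTop (𝓝 (ENNReal.ofReal
      ((Q.rho * Q.K / (2 * Q.mu * (1 - Q.rho)) + 1 / Q.mu) / (1 - φ * Q.rho) - 1 / Q.mu))) := by
  have hs := Q.service_prob
  have hmu := Q.mu_pos
  have hrho := Q.rho_lt_one
  have hrho0 := Q.rho_pos
  have hload := Q.prem_load_lt_one φ
  rw [prem_load_eq] at hload
  have hφ := mul_nonneg φ.2.1 hrho0.le
  have hstab : Q.lam * (posMoment 1 Q.service).toReal < 1 := by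
    rw [toReal_posMoment_service_one]
    exact Q.stable
  have h2 := Q.posMoment_service_two_ne_top
  have h := ENNReal.tendsto_ofReal
    (tendsto_posMoment_one_lindleyLaw Q.lam_pos Q.service_nonneg h2 hstab)
  simp only [ENNReal.ofReal_toReal (posMoment_one_lindleyLaw_ne_top Q.lam_pos Q.service_nonneg h2 _)]
    at h
  have hlim := (ENNReal.Tendsto.const_mul h (Or.inr (ENNReal.ofReal_ne_top
    (r := 1 / (1 - φ * Q.rho))))).add_const (ENNReal.ofReal (1 / (1 - φ * Q.rho)) *
      posMoment 1 Q.service - posMoment 1 Q.service)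
  simp only [← ordMeanDelay_eq] at hlim
  convert hlim using 2
  have e1 : posMoment 1 Q.service = ENNReal.ofReal (1 / Q.mu) := by
    rw [← mean_eq, ← toReal_posMoment_service_one,
      ENNReal.ofReal_toReal Q.posMoment_service_one_ne_top]
  have hd : 0 < 1 - φ * Q.rho := by linarith
  have hd' : 0 < 1 - Q.rho := by linarith
  have hK := Q.K_nonneg
  rw [toReal_posMoment_service_two, toReal_posMoment_service_one, sq_eq, mean_eq, e1,
    ← ENNReal.ofReal_mul (by positivity), ← ENNReal.ofReal_mul (by positivity),
    ← ENNReal.ofReal_sub _ (by positivity), lam_eq, ← ENNReal.ofReal_add]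
  · congr 1
    have e : Q.rho * Q.mu * (1 / Q.mu) = Q.rho := by field_simp
    rw [e]
    field_simp
    ring
  · have e : Q.rho * Q.mu * (1 / Q.mu) = Q.rho := by field_simp
    rw [e]
    have := Q.mu_pos
    positivity
  · rw [sub_nonneg]
    refine le_mul_of_one_le_left (by positivity) ?_
    rw [le_div_iff₀ hd]
    linarith

end MG1Queue

/-! ### Shape of C(φ), equilibria and their stability -/

namespace MG1Queue

variable (Q : MG1Queue)

lemma one_sub_mul_rho_pos (φ : I) : 0 < 1 - (φ : ℝ) * Q.rho := by
  have h := Q.prem_load_lt_one φ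
  rw [prem_load_eq] at h
  linarith

lemma Wp_eq (φ : I) : Q.Wp φ = φ * Q.rho * Q.K / (2 * Q.mu * (1 - φ * Q.rho)) := by
  rw [Wp, (Q.tendsto_premMeanDelay φ).limUnder_eq, ENNReal.toReal_ofReal]
  have h1 := Q.one_sub_mul_rho_pos φ
  have h2 := Q.mu_pos
  have h3 := Q.rho_pos
  have h4 := Q.K_nonneg
  have h5 := φ.2.1
  positivity

lemma Wo_eq (φ : I) : Q.Wo φ =
    (Q.rho * Q.K / (2 * Q.mu * (1 - Q.rho)) + 1 / Q.mu) / (1 - φ * Q.rho) - 1 / Q.mu := by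
  rw [Wo, (Q.tendsto_ordMeanDelay φ).limUnder_eq, ENNReal.toReal_ofReal]
  have h1 := Q.one_sub_mul_rho_pos φ
  have h2 := Q.mu_pos
  have h3 := Q.rho_pos
  have h4 := Q.K_nonneg
  have h5 : 0 < 1 - Q.rho := sub_pos.2 Q.rho_lt_one
  have h6 := mul_nonneg φ.2.1 h3.le
  have h7 : 0 ≤ Q.rho * Q.K / (2 * Q.mu * (1 - Q.rho)) := by positivity
  have h8 : 0 < 1 / Q.mu := by positivity
  rw [sub_nonneg, le_div_iff₀ h1]
  nlinarith

lemma Cfun_eq (φ : I) : Q.Cfun φ =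
    (Q.K * Q.rho + (2 - Q.K) * (φ : ℝ) * Q.rho * (1 - Q.rho))
      / (2 * Q.mu * (1 - Q.rho) * (1 - (φ : ℝ) * Q.rho)) := by
  have h1 := (Q.one_sub_mul_rho_pos φ).ne'
  have h2 := Q.mu_pos.ne'
  have h5 : 1 - Q.rho ≠ 0 := (sub_pos.2 Q.rho_lt_one).ne'
  rw [Cfun, Wp_eq, Wo_eq]
  generalize (φ : ℝ) = x at h1 ⊢
  rw [mul_comm x] at h1 ⊢
  field_simp
  ring

lemma continuous_Cfun : Continuous Q.Cfun := by
  have h2 := Q.mu_pos.ne'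
  have h5 : 1 - Q.rho ≠ 0 := (sub_pos.2 Q.rho_lt_one).ne'
  rw [funext Q.Cfun_eq]
  refine Continuous.div (by fun_prop) (by fun_prop) fun φ => ?_
  have h1 := (Q.one_sub_mul_rho_pos φ).ne'
  positivity

/-- The numerator of the derivative of `C(φ)`, up to a positive factor. -/
noncomputable def slope : ℝ := (2 - Q.K) * (1 - Q.rho) + Q.K * Q.rho

/-- A difference of values of a Möbius function factors; the last factor is positive, so `slope`
alone decides the direction. -/
lemma Cfun_sub (φ ψ : I) : Q.Cfun φ - Q.Cfun ψ = ((φ : ℝ) - ψ) * Q.slope *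
    (Q.rho / (2 * Q.mu * (1 - Q.rho) * (1 - φ * Q.rho) * (1 - ψ * Q.rho))) := by
  have h1 := (Q.one_sub_mul_rho_pos φ).ne'
  have h1' := (Q.one_sub_mul_rho_pos ψ).ne'
  have h2 := Q.mu_pos.ne'
  have h5 : 1 - Q.rho ≠ 0 := (sub_pos.2 Q.rho_lt_one).ne'
  rw [Cfun_eq, Cfun_eq, slope]
  generalize (φ : ℝ) = x at h1 ⊢
  generalize (ψ : ℝ) = y at h1' ⊢
  rw [mul_comm x] at h1 ⊢
  rw [mul_comm y] at h1' ⊢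
  field_simp
  ring

lemma Cfun_sub_factor_pos (φ ψ : I) :
    0 < Q.rho / (2 * Q.mu * (1 - Q.rho) * (1 - φ * Q.rho) * (1 - ψ * Q.rho)) := by
  have h1 := Q.one_sub_mul_rho_pos φ
  have h1' := Q.one_sub_mul_rho_pos ψ
  have h2 := Q.mu_pos
  have h3 := Q.rho_pos
  have h5 : 0 < 1 - Q.rho := sub_pos.2 Q.rho_lt_one
  positivity

lemma strictMono_Cfun (h : 0 < Q.slope) : StrictMono Q.Cfun := fun φ ψ hφψ => by
  rw [← sub_pos, Cfun_sub]
  exact mul_pos (mul_pos (sub_pos.2 hφψ) h) (Q.Cfun_sub_factor_pos _ _)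

lemma strictAnti_Cfun (h : Q.slope < 0) : StrictAnti Q.Cfun := fun φ ψ hφψ => by
  rw [← sub_neg, Cfun_sub]
  exact mul_neg_of_neg_of_pos (mul_neg_of_pos_of_neg (sub_pos.2 hφψ) h)
    (Q.Cfun_sub_factor_pos _ _)

lemma Cfun_const (h : Q.slope = 0) (φ ψ : I) : Q.Cfun φ = Q.Cfun ψ := by
  rw [← sub_eq_zero, Cfun_sub, h, mul_zero, zero_mul]

lemma monotone_or_strictAnti_Cfun : Monotone Q.Cfun ∨ StrictAnti Q.Cfun := by
  rcases lt_trichotomy Q.slope 0 with h | h | h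
  · exact Or.inr (Q.strictAnti_Cfun h)
  · exact Or.inl fun φ ψ _ => (Q.Cfun_const h φ ψ).le
  · exact Or.inl (Q.strictMono_Cfun h).monotone

lemma eq_phiE {C : ℝ} {φ : I} (hs : Q.slope ≠ 0) (h : Q.Cfun φ = C) : (φ : ℝ) = Q.phiE C := by
  have h1 := (Q.one_sub_mul_rho_pos φ).ne'
  have h2 := Q.mu_pos.ne'
  have h3 := Q.rho_pos.ne'
  have h5 : 1 - Q.rho ≠ 0 := (sub_pos.2 Q.rho_lt_one).ne'
  rw [Cfun_eq, div_eq_iff (by positivity)] at h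
  -- At a solution this quantity times (1 - ρ)(1 - φρ) equals `slope`, so the denominator of `phiE`
  -- cannot vanish.
  have hX : 2 * Q.mu * C + 2 - Q.K ≠ 0 := fun h0 => hs (by
    have e : (2 * Q.mu * C + 2 - Q.K) * ((1 - Q.rho) * (1 - φ * Q.rho)) = Q.slope := by
      rw [slope]
      linear_combination -h
    rw [← e, h0, zero_mul])
  rw [phiE, eq_div_iff (mul_ne_zero (mul_ne_zero h3 h5) hX)]
  linear_combination h

lemma cost_sub (C : ℝ) (q q' φ : I) :
    Q.cost C q φ - Q.cost C q' φ = ((q : ℝ) - q') * (C - Q.Cfun φ) := by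
  rw [cost, cost, Cfun]
  ring

lemma isBestResponse_iff (C : ℝ) (q φ : I) :
    Q.IsBestResponse C q φ ↔ (Q.Cfun φ < C → q = 0) ∧ (C < Q.Cfun φ → q = 1) := by
  have hb : ∀ r : I, Q.cost C q φ ≤ Q.cost C r φ ↔ ((q : ℝ) - r) * (C - Q.Cfun φ) ≤ 0 :=
    fun r => by rw [← cost_sub, sub_nonpos]
  simp only [IsBestResponse, hb]
  constructor
  · refine fun h => ⟨fun hC => ?_, fun hC => ?_⟩
    · have h0 := h 0
      refine le_antisymm ?_ q.2.1
      by_contra hq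
      have hq' : 0 < (q : ℝ) := not_le.1 hq
      have := mul_pos hq' (sub_pos.2 hC)
      simp only [Icc.coe_zero, sub_zero] at h0
      linarith
    · have h1 := h 1
      refine le_antisymm q.2.2 ?_
      by_contra hq
      have hq' : (q : ℝ) < 1 := not_le.1 hq
      have := mul_pos_of_neg_of_neg (sub_neg.2 hq') (sub_neg.2 hC)
      simp only [Icc.coe_one] at h1
      linarith
  · rintro ⟨h0, h1⟩ r
    rcases lt_trichotomy (Q.Cfun φ) C with h | h | h
    · rw [h0 h, Icc.coe_zero, zero_sub]
      exact mul_nonpos_of_nonpos_of_nonneg (neg_nonpos.2 r.2.1) (sub_pos.2 h).le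
    · rw [h, sub_self, mul_zero]
    · rw [h1 h, Icc.coe_one]
      exact mul_nonpos_of_nonneg_of_nonpos (sub_nonneg.2 r.2.2) (sub_neg.2 h).le

lemma isEquilibrium_iff (C : ℝ) (φ : I) :
    Q.IsEquilibrium C φ ↔ (Q.Cfun φ < C → φ = 0) ∧ (C < Q.Cfun φ → φ = 1) :=
  Q.isBestResponse_iff C φ φ

variable {Q}

lemma IsEquilibrium.Cfun_eq_of_mixed {C : ℝ} {φ : I} (h : Q.IsEquilibrium C φ) (h0 : 0 < φ)
    (h1 : φ < 1) : Q.Cfun φ = C := by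
  rw [isEquilibrium_iff] at h
  exact le_antisymm (not_lt.1 fun hC => h1.ne (h.2 hC)) (not_lt.1 fun hC => h0.ne' (h.1 hC))

/-- A sign condition on populations near `φ` that makes `φ` resist a rare strategy `q`. -/
lemma cost_lt_of_eventually {C : ℝ} {φ q : I} {P : I → Prop} (hP : ∀ᶠ ψ in 𝓝 φ, P ψ)
    (h : ∀ ψ : I, P ψ → 0 < ((ψ : ℝ) - φ) * (q - φ) →
      ((φ : ℝ) - q) * (C - Q.Cfun ψ) < 0) (hq : q ≠ φ) :
    ∃ ε₀ : ℝ, 0 < ε₀ ∧ ∀ ε : ℝ, 0 < ε → ε < ε₀ → ∀ ψ : I,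
      (ψ : ℝ) = (1 - ε) * φ + ε * q → Q.cost C φ ψ < Q.cost C q ψ := by
  obtain ⟨δ, hδ, hball⟩ := Metric.eventually_nhds_iff.1 hP
  refine ⟨δ, hδ, fun ε hε hεδ ψ hψ => ?_⟩
  have hsub : (ψ : ℝ) - φ = ε * (q - φ) := by rw [hψ]; ring
  have hne : (q : ℝ) - φ ≠ 0 := sub_ne_zero.2 fun h => hq (Subtype.ext h)
  rw [← sub_neg, cost_sub]
  refine h ψ (hball ?_) ?_
  · rw [Subtype.dist_eq, Real.dist_eq, hsub, abs_mul, abs_of_pos hε]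
    have : |(q : ℝ) - φ| ≤ 1 := by
      rw [abs_le]
      constructor <;> linarith [q.2.1, q.2.2, φ.2.1, φ.2.2]
    nlinarith [abs_nonneg ((q : ℝ) - φ)]
  · rw [hsub, mul_assoc]
    exact mul_pos hε (mul_self_pos.2 hne)

/-- If C(0) < C, continuity keeps staying ordinary strictly better near 0. If C(0) = C, strict
decrease gives the same in every population with some joiners. -/
lemma isESS_zero {C : ℝ} (heq : Q.IsEquilibrium C 0)
    (h : StrictAnti Q.Cfun ∨ C ≠ Q.Cfun 0) : Q.IsESS C 0 ∧ Q.CannotBeInvaded C 0 := by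
  have hle : Q.Cfun 0 ≤ C := not_lt.1 fun hC =>
    zero_ne_one (((Q.isEquilibrium_iff C 0).1 heq).2 hC)
  have hnear : ∀ᶠ ψ in 𝓝 (0 : I), 0 < ψ → Q.Cfun ψ < C := by
    rcases h with h | h
    · exact Eventually.of_forall fun ψ hψ => (h hψ).trans_le hle
    · exact (Q.continuous_Cfun.continuousAt.eventually_lt_const
        (lt_of_le_of_ne hle h.symm)).mono fun ψ hψ _ => hψ
  refine ⟨⟨heq, ?_⟩, fun q hq => cost_lt_of_eventually hnear (fun ψ hψ hpos => ?_) hq⟩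
  · rintro ⟨ψ, hne, hψ, hbr⟩
    rcases h with h | h
    · exact hne (((Q.isEquilibrium_iff C ψ).1 hψ).1
        ((h (unitInterval.pos_iff_ne_zero.2 hne)).trans_le hle))
    · exact hne (((Q.isBestResponse_iff C ψ 0).1 hbr).1 (lt_of_le_of_ne hle h.symm))
  · simp only [Icc.coe_zero, sub_zero, zero_sub] at hpos ⊢
    have hq0 : 0 < (q : ℝ) := unitInterval.pos_iff_ne_zero.2 hq
    have hψ0 : 0 < (ψ : ℝ) := pos_of_mul_pos_left hpos hq0.le
    have := mul_pos hq0 (sub_pos.2 (hψ hψ0))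
    linarith

lemma isESS_one {C : ℝ} (heq : Q.IsEquilibrium C 1)
    (h : StrictAnti Q.Cfun ∨ C ≠ Q.Cfun 1) : Q.IsESS C 1 ∧ Q.CannotBeInvaded C 1 := by
  have hle : C ≤ Q.Cfun 1 := not_lt.1 fun hC =>
    one_ne_zero (((Q.isEquilibrium_iff C 1).1 heq).1 hC)
  have hnear : ∀ᶠ ψ in 𝓝 (1 : I), ψ < 1 → C < Q.Cfun ψ := by
    rcases h with h | h
    · exact Eventually.of_forall fun ψ hψ => hle.trans_lt (h hψ)
    · exact (Q.continuous_Cfun.continuousAt.eventually_const_lt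
        (lt_of_le_of_ne hle h)).mono fun ψ hψ _ => hψ
  refine ⟨⟨heq, ?_⟩, fun q hq => cost_lt_of_eventually hnear (fun ψ hψ hpos => ?_) hq⟩
  · rintro ⟨ψ, hne, hψ, hbr⟩
    rcases h with h | h
    · exact hne (((Q.isEquilibrium_iff C ψ).1 hψ).2
        (hle.trans_lt (h (unitInterval.lt_one_iff_ne_one.2 hne))))
    · exact hne (((Q.isBestResponse_iff C ψ 1).1 hbr).2 (lt_of_le_of_ne hle h))
  · simp only [Icc.coe_one] at hpos ⊢
    have hq1 : (q : ℝ) < 1 := unitInterval.lt_one_iff_ne_one.2 hq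
    have hψ1 : (ψ : ℝ) < 1 := by nlinarith
    have := mul_pos (sub_pos.2 hq1) (sub_pos.2 (hψ hψ1))
    linarith

/-- Negative feedback: a rare strategy shifts the population in its own direction, which makes that
direction costlier. No smallness of ε is needed. -/
lemma cannotBeInvaded_of_strictAnti {C : ℝ} {φ : I} (h : StrictAnti Q.Cfun) (hC : Q.Cfun φ = C) :
    Q.CannotBeInvaded C φ := fun q hq => by
  refine cost_lt_of_eventually (P := fun _ => True) (Eventually.of_forall fun _ => trivial)
    (fun ψ _ hpos => ?_) hq
  rw [← hC]
  rcases lt_trichotomy φ ψ with hlt | rfl | hlt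
  · have h1 : 0 < (q : ℝ) - φ := pos_of_mul_pos_right hpos (sub_nonneg.2 hlt.le)
    nlinarith [h hlt]
  · simp at hpos
  · have h1 : (ψ : ℝ) - φ < 0 := sub_neg.2 hlt
    have h2 : (q : ℝ) - φ < 0 := by nlinarith
    nlinarith [h hlt]

/-- The invader is q = 1: its presence cannot lower the value of joining, so φ never does strictly
better. -/
lemma not_cannotBeInvaded_of_monotone {C : ℝ} {φ : I} (h : Monotone Q.Cfun)
    (hC : Q.Cfun φ = C) (h1 : φ < 1) : ¬ Q.CannotBeInvaded C φ := fun hinv => by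
  obtain ⟨ε₀, hε₀, hlt⟩ := hinv 1 h1.ne'
  -- Halving keeps ε strictly below ε₀; the cap at 1 keeps the mixed population in [0, 1].
  set ε := min ε₀ 1 / 2 with hε
  have hmin : 0 < min ε₀ 1 := lt_min hε₀ one_pos
  have hε1 : ε ≤ 1 := by linarith [min_le_right ε₀ 1]
  have h1' : (φ : ℝ) ≤ 1 := φ.2.2
  have h0 : (0 : ℝ) ≤ φ := φ.2.1
  let ψ : I := ⟨(1 - ε) * φ + ε * 1, by nlinarith, by nlinarith⟩
  have hψ : φ ≤ ψ := by
    change (φ : ℝ) ≤ (1 - ε) * φ + ε * 1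
    nlinarith
  have hcost := hlt ε (by linarith) (by linarith [min_le_left ε₀ 1]) ψ rfl
  rw [← sub_neg, cost_sub, Icc.coe_one, ← hC] at hcost
  have := mul_nonneg_of_nonpos_of_nonpos (sub_nonpos.2 h1') (sub_nonpos.2 (h hψ))
  linarith

/-- Above φ joining is not worth C, which forces ψ = 0; below φ it is worth more, which forces ψ =
1. Both contradict the position of ψ. -/
lemma equilibrium_unique_of_strictAnti {C : ℝ} {φ ψ : I} (h : StrictAnti Q.Cfun)
    (hC : Q.Cfun φ = C) (hψ : Q.IsEquilibrium C ψ) : ψ = φ := by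
  rw [isEquilibrium_iff, ← hC, h.lt_iff_gt, h.lt_iff_gt] at hψ
  rcases lt_trichotomy φ ψ with hlt | heq | hlt
  · rw [hψ.1 hlt] at hlt
    exact absurd hlt (not_lt.2 φ.2.1)
  · exact heq.symm
  · rw [hψ.2 hlt] at hlt
    exact absurd hlt (not_lt.2 φ.2.2)

end MG1Queue

theorem theorem1 (Q : MG1Queue) :
    -- the steady-state expected waiting times exist and are finite
    (∀ φ : I, Tendsto (Q.premMeanDelay φ) atTop (𝓝 (ENNReal.ofReal (Q.Wp φ))) ∧
      Tendsto (Q.ordMeanDelay φ) atTop (𝓝 (ENNReal.ofReal (Q.Wo φ)))) ∧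
    -- the formula for `C(φ)`
    (∀ φ : I, Q.Cfun φ =
      (Q.K * Q.rho + (2 - Q.K) * (φ : ℝ) * Q.rho * (1 - Q.rho))
        / (2 * Q.mu * (1 - Q.rho) * (1 - (φ : ℝ) * Q.rho))) ∧
    -- `C(φ)` has a minimum `m` and a maximum `M`, and for every price `C`:
    ∃ m M : ℝ, IsLeast (range Q.Cfun) m ∧ IsGreatest (range Q.Cfun) M ∧ ∀ C : ℝ,
      (C < m → ∀ φ : I, Q.IsEquilibrium C φ ↔ φ = 1) ∧
      (M < C → ∀ φ : I, Q.IsEquilibrium C φ ↔ φ = 0) ∧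
      (m < C → C < M → Antitone Q.Cfun →
        ∃ φe : I, (φe : ℝ) = Q.phiE C ∧ 0 < φe ∧ φe < 1 ∧
          ∀ φ : I, Q.IsEquilibrium C φ ↔ φ = φe) ∧
      (m < C → C < M → Monotone Q.Cfun →
        ∃ φe : I, (φe : ℝ) = Q.phiE C ∧ 0 < φe ∧ φe < 1 ∧
          ∀ φ : I, Q.IsEquilibrium C φ ↔ φ = 1 ∨ φ = 0 ∨ φ = φe) ∧
      -- pure equilibria are ESS
      (StrictAnti Q.Cfun ∨ (C ≠ m ∧ C ≠ M) → ∀ φ : I, Q.IsEquilibrium C φ → φ = 0 ∨ φ = 1 →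
        Q.IsESS C φ ∧ Q.CannotBeInvaded C φ) ∧
      -- a mixed equilibrium is ESS if and only if it is the unique equilibrium
      (∀ φ : I, Q.IsEquilibrium C φ → 0 < φ → φ < 1 →
        (Q.IsESS C φ ↔ ∀ ψ : I, Q.IsEquilibrium C ψ → ψ = φ) ∧
        (Q.CannotBeInvaded C φ ↔ ∀ ψ : I, Q.IsEquilibrium C ψ → ψ = φ)) := by
  refine ⟨fun φ => ⟨?_, ?_⟩, Q.Cfun_eq, ?_⟩
  · rw [Q.Wp_eq]
    exact Q.tendsto_premMeanDelay φ
  · rw [Q.Wo_eq]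
    exact Q.tendsto_ordMeanDelay φ
  obtain ⟨m, hm⟩ := (isCompact_range Q.continuous_Cfun).exists_isLeast (range_nonempty _)
  obtain ⟨M, hM⟩ := (isCompact_range Q.continuous_Cfun).exists_isGreatest (range_nonempty _)
  have hml : ∀ φ, m ≤ Q.Cfun φ := fun φ => hm.2 (mem_range_self φ)
  have hMg : ∀ φ, Q.Cfun φ ≤ M := fun φ => hM.2 (mem_range_self φ)
  have hext : (Q.Cfun 0 = m ∧ Q.Cfun 1 = M) ∨ (Q.Cfun 0 = M ∧ Q.Cfun 1 = m) := by
    obtain ⟨φm, hφm⟩ := hm.1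
    obtain ⟨φM, hφM⟩ := hM.1
    rcases Q.monotone_or_strictAnti_Cfun with h | h
    · exact Or.inl ⟨le_antisymm (hφm ▸ h φm.2.1) (hml 0), le_antisymm (hMg 1) (hφM ▸ h φM.2.2)⟩
    · exact Or.inr ⟨le_antisymm (hMg 0) (hφM ▸ h.antitone φM.2.1),
        le_antisymm (hφm ▸ h.antitone φm.2.2) (hml 1)⟩
  refine ⟨m, M, hm, hM, fun C => ?_⟩
  -- With zero slope C(·) would be constant and m = M.
  have hslope : m < C → C < M → Q.slope ≠ 0 := fun h1 h2 h0 => by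
    have := Q.Cfun_const h0 0 1
    rcases hext with h | h <;> linarith
  have hivt : m < C → C < M → ∃ φe : I, Q.Cfun φe = C := fun h1 h2 =>
    mem_range_of_exists_le_of_exists_ge Q.continuous_Cfun
      (hm.1.imp fun _ h => h.le.trans h1.le) (hM.1.imp fun _ h => h2.le.trans h.ge)
  have hmixed : ∀ φe : I, m < C → C < M → Q.Cfun φe = C → 0 < φe ∧ φe < 1 := by
    intro φe h1 h2 he
    refine ⟨unitInterval.pos_iff_ne_zero.2 ?_, unitInterval.lt_one_iff_ne_one.2 ?_⟩ <;> rintro rfl <;>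
      rcases hext with h | h <;> linarith
  have heq : ∀ {φ : I}, Q.Cfun φ = C → Q.IsEquilibrium C φ := fun h =>
    (Q.isEquilibrium_iff C _).2 ⟨fun h' => absurd h h'.ne, fun h' => absurd h h'.ne'⟩
  refine ⟨fun hC φ => ?_, fun hC φ => ?_, fun h1 h2 hanti => ?_, fun h1 h2 hmono => ?_,
    fun h φ hφ hpure => ?_, fun φ hφ h0 h1 => ?_⟩
  · have := hC.trans_le (hml φ)
    rw [Q.isEquilibrium_iff]
    exact ⟨fun h => h.2 this, fun h => ⟨fun h' => absurd h' this.not_gt, fun _ => h⟩⟩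
  · have := (hMg φ).trans_lt hC
    rw [Q.isEquilibrium_iff]
    exact ⟨fun h => h.1 this, fun h => ⟨fun _ => h, fun h' => absurd h' this.not_gt⟩⟩
  · obtain ⟨φe, he⟩ := hivt h1 h2
    have hs : StrictAnti Q.Cfun := by
      rcases (hslope h1 h2).lt_or_gt with h | h
      · exact Q.strictAnti_Cfun h
      · exact absurd (hanti (zero_le_one (α := I))) (Q.strictMono_Cfun h zero_lt_one).not_ge
    exact ⟨φe, Q.eq_phiE (hslope h1 h2) he, (hmixed φe h1 h2 he).1, (hmixed φe h1 h2 he).2,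
      fun φ => ⟨MG1Queue.equilibrium_unique_of_strictAnti hs he, fun h => heq (h ▸ he)⟩⟩
  · obtain ⟨φe, he⟩ := hivt h1 h2
    have hs : StrictMono Q.Cfun := by
      rcases (hslope h1 h2).lt_or_gt with h | h
      · exact absurd (hmono (zero_le_one (α := I))) (Q.strictAnti_Cfun h zero_lt_one).not_ge
      · exact Q.strictMono_Cfun h
    obtain ⟨hpos, hlt⟩ := hmixed φe h1 h2 he
    refine ⟨φe, Q.eq_phiE (hslope h1 h2) he, hpos, hlt, fun φ => ⟨fun h => ?_, ?_⟩⟩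
    · rw [Q.isEquilibrium_iff] at h
      rcases lt_trichotomy (Q.Cfun φ) C with h' | h' | h'
      · exact Or.inr (Or.inl (h.1 h'))
      · exact Or.inr (Or.inr (hs.injective (h'.trans he.symm)))
      · exact Or.inl (h.2 h')
    · have hC0 : Q.Cfun 0 < C := he ▸ hs hpos
      have hC1 : C < Q.Cfun 1 := he ▸ hs hlt
      rintro (rfl | rfl | rfl)
      · exact (Q.isEquilibrium_iff C 1).2 ⟨fun h => absurd h hC1.not_gt, fun _ => rfl⟩
      · exact (Q.isEquilibrium_iff C 0).2 ⟨fun _ => rfl, fun h => absurd h hC0.not_gt⟩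
      · exact heq he
  · rcases hpure with rfl | rfl
    · refine MG1Queue.isESS_zero hφ (h.imp_right fun h => ?_)
      rcases hext with h' | h' <;> rw [h'.1]
      exacts [h.1, h.2]
    · refine MG1Queue.isESS_one hφ (h.imp_right fun h => ?_)
      rcases hext with h' | h' <;> rw [h'.2]
      exacts [h.2, h.1]
  · have hC := hφ.Cfun_eq_of_mixed h0 h1
    refine ⟨⟨fun h ψ hψ => ?_, fun h => ⟨hφ, ?_⟩⟩, ?_⟩
    -- At an indifference point every strategy is a best response, so any other equilibrium would
    -- violate ESS.
    · by_contra hne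
      exact h.2 ⟨ψ, hne, hψ, (Q.isBestResponse_iff C ψ φ).2
        ⟨fun h' => absurd hC h'.ne, fun h' => absurd hC h'.ne'⟩⟩
    · rintro ⟨ψ, hne, hψ, _⟩
      exact hne (h ψ hψ)
    · rcases Q.monotone_or_strictAnti_Cfun with hmono | hs
      -- Here C = C(φ) ≤ C(1), so 1 is a second equilibrium and both sides fail; this covers
      -- constant C(·).
      · refine iff_of_false (MG1Queue.not_cannotBeInvaded_of_monotone hmono hC h1) fun h => ?_
        refine h1.ne' (h 1 ((Q.isEquilibrium_iff C 1).2 ⟨fun h' => ?_, fun _ => rfl⟩))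
        exact absurd (hC ▸ hmono h1.le) (not_le.2 h')
      · exact iff_of_true (MG1Queue.cannotBeInvaded_of_strictAnti hs hC) fun ψ hψ =>
          MG1Queue.equilibrium_unique_of_strictAnti hs hC hψ
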